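/- **Setting.** $L_{2e}^n$ is the space of locally square integrable signals $x:[0,\infty)\to\mathbb R^n$ (modulo equality almost everywhere), $L_2^n\subset L_{2e}^n$ the signals of finite norm $\|x\|=(\int_0^\infty x^Tx\,dt)^{1/2}$, and $P_T$ ($T>0$) the truncation with $P_Tx=x$ on $[0,T]$ and $P_Tx=0$ on $(T,\infty)$. A map $S:L_{2e}^n\to L_{2e}^m$ is *causal* if $P_TS=P_TSP_T$ for all $T>0$, and *bounded* if there is $\gamma\ge 0$ with $\|S(x)\|\le\gamma\|x\|$ for all $x\in L_2^n$. A real rational matrix $H$ is in $RH_\infty$ if it is proper and has no poles in the closed right half-plane; it also denotes the system $L_{2e}\to L_{2e}$, $w\mapsto C_Hx+D_Hw$, $\dot x=A_Hx+B_Hw$, $x(0)=0$, for a realization $H(s)=C_H(sI-A_H)^{-1}B_H+D_H$ with $A_H$ Hurwitz. For $x\in L_2^n$, $\hat x$ is the Fourier transform. Let $\Psi(s)=C_\Psi(sI-A_\Psi)^{-1}B_\Psi+D_\Psi$ be an $n_y\times(n_z+n_w)$ transfer matrix with $A_\Psi$ Hurwitz, let $M=M^T\in\mathbb R^{n_y\times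 n_y}$, and let $\Pi=\Psi^*M\Psi$, where $\Psi^*(s)=\Psi(-s)^T$. A matrix $\tilde Z=\tilde Z^T$ *certifies a canonical factorization* of $\Pi$ if there are real matrices $\tilde M=\tilde M^T$, $\tilde C$ and an invertible $\tilde D$ with $$\begin{pmatrix}I&0\\A_\Psi&B_\Psi\\C_\Psi&D_\Psi\end{pmatrix}^T\begin{pmatrix}0&\tilde Z&0\\\tilde Z&0&0\\0&0&M\end{pmatrix}\begin{pmatrix}I&0\\A_\Psi&B_\Psi\\C_\Psi&D_\Psi\end{pmatrix}=\begin{pmatrix}\tilde C&\tilde D\end{pmatrix}^T\tilde M\begin{pmatrix}\tilde C&\tilde D\end{pmatrix}$$ and $A_\Psi-B_\Psi\tilde D^{-1}\tilde C$ Hurwitz (then $\Pi=\tilde\Psi^*\tilde M\tilde\Psi$ with $\tilde\Psi(s)=\tilde C(sI-A_\Psi)^{-1}B_\Psi+\tilde D$ and $\tilde\Psi,\tilde\Psi^{-1}\in RH_\infty$). **Lemma.** Let $\Delta:L_{2e}^{n_z}\to L_{2e}^{n_w}$ be causal and bounded and satisfy the soft (infinite-horizon) IQC $$\int_{-\infty}^\infty\begin{pmatrix}\hat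 z(i\omega)\\\widehat{\Delta(z)}(i\omega)\end{pmatrix}^*\Pi(i\omega)\begin{pmatrix}\hat z(i\omega)\\\widehat{\Delta(z)}(i\omega)\end{pmatrix}d\omega\ge 0\quad\text{for all }z\in L_2^{n_z}.$$ Let $\tilde Z$ certify a canonical factorization of $\Pi=\Psi^*M\Psi$, and suppose that $$\begin{pmatrix}H(i\omega)\\I\end{pmatrix}^*\Pi(i\omega)\begin{pmatrix}H(i\omega)\\I\end{pmatrix}\preceq 0\quad\text{for all }\omega\in\mathbb R$$ (and hence, by continuity, also at $\infty$) for some $H\in RH_\infty^{n_z\times n_w}$ for which $I-H\Delta:L_{2e}^{n_z}\to L_{2e}^{n_z}$ has a causal and bounded inverse. Then $\Delta$ satisfies a finite-horizon IQC with terminal cost matrix $\tilde Z$ with respect to $\Pi=\Psi^*M\Psi$: for every $z\in L_{2e}^{n_z}$, the trajectories of $$\dot\xi=A_\Psi\xi+B_\Psi u,\quad\xi(0)=0,\quad y=C_\Psi\xi+D_\Psi u,\qquad u=\begin{pmatrix}z\\\Delta(z)\end{pmatrix},$$ satisfy $$\int_0^Ty(t)^TMy(t)\,dt+\xi(T)^T\tilde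 Z\xi(T)\ge 0\quad\text{for all }T>0.$$ -/

import Mathlib

open MeasureTheory Set

open scoped Matrix ComplexOrder ENNReal NNReal FourierTransform

noncomputable section

/-! ### Signals on the half line and systems -/

/-- Lebesgue measure on the time axis `[0, ∞)`. -/
abbrev halfLine : Measure ℝ := volume.restrict (Ici (0 : ℝ))

lemma restrict_Icc_le_halfLine (T : ℝ) : volume.restrict (Icc 0 T) ≤ halfLine :=
  Measure.restrict_mono Icc_subset_Ici_self le_rfl

lemma ae_Icc_of_ae_halfLine {p : ℝ → Prop} (h : ∀ᵐ t ∂halfLine, p t) (T : ℝ) :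
    ∀ᵐ t ∂volume.restrict (Icc 0 T), p t :=
  ae_mono (restrict_Icc_le_halfLine T) h

/-- The locally square integrable functions as a subspace of all measurable functions. -/
def locallyL2 (n : ℕ) : Submodule ℝ (ℝ →ₘ[halfLine] EuclideanSpace ℝ (Fin n)) where
  carrier := {x | ∀ T : ℝ, MemLp x 2 (volume.restrict (Icc 0 T))}
  zero_mem' := fun T => by
    refine (memLp_congr_ae (ae_Icc_of_ae_halfLine AEEqFun.coeFn_zero T)).2 ?_
    exact MemLp.zero'
  add_mem' := fun {x y} hx hy T =>
    (memLp_congr_ae (ae_Icc_of_ae_halfLine (AEEqFun.coeFn_add x y) T)).2 ((hx T).add (hy T))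
  smul_mem' := fun c x hx T =>
    (memLp_congr_ae (ae_Icc_of_ae_halfLine (AEEqFun.coeFn_smul c x) T)).2 ((hx T).const_smul c)

/-- The space `L_{2e}^n` of locally square integrable signals `[0, ∞) → ℝⁿ`
(classes of functions modulo equality almost everywhere). -/
abbrev L2e (n : ℕ) : Type := locallyL2 n

/-- The values `x t ∈ ℝⁿ` of a signal. -/
def L2e.val {n : ℕ} (x : L2e n) (t : ℝ) : EuclideanSpace ℝ (Fin n) := x.1 t

/-- The `L₂`-norm `‖x‖ ∈ [0, ∞]` of a signal. -/
def L2e.norm2 {n : ℕ} (x : L2e n) : ℝ≥0∞ := eLpNorm x.val 2 halfLine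

/-- `x ∈ L₂ⁿ`. -/
def L2e.InL2 {n : ℕ} (x : L2e n) : Prop := x.norm2 < ∞

lemma aestronglyMeasurable_halfLine {E : Type*} [NormedAddCommGroup E] {f : ℝ → E}
    (h : ∀ T : ℝ, AEStronglyMeasurable f (volume.restrict (Icc 0 T))) :
    AEStronglyMeasurable f halfLine := by
  have hU : Ici (0 : ℝ) = ⋃ k : ℕ, Icc (0 : ℝ) k := by
    ext t
    simp only [mem_Ici, mem_iUnion, mem_Icc]
    exact ⟨fun ht => (exists_nat_ge t).imp fun k hk => ⟨ht, hk⟩, fun ⟨_, h⟩ => h.1⟩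
  rw [halfLine, hU, aestronglyMeasurable_iUnion_iff]
  exact fun k => h k

/-- The signal defined by a locally square integrable function. -/
def L2e.mk {n : ℕ} (f : ℝ → EuclideanSpace ℝ (Fin n))
    (hf : ∀ T : ℝ, MemLp f 2 (volume.restrict (Icc 0 T))) : L2e n :=
  ⟨AEEqFun.mk f (aestronglyMeasurable_halfLine fun T => (hf T).1), fun T =>
    (memLp_congr_ae (ae_Icc_of_ae_halfLine (AEEqFun.coeFn_mk _ _) T)).2 (hf T)⟩

lemma L2e.val_mk {n : ℕ} (f : ℝ → EuclideanSpace ℝ (Fin n))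
    (hf : ∀ T : ℝ, MemLp f 2 (volume.restrict (Icc 0 T))) :
    (L2e.mk f hf).val =ᵐ[halfLine] f :=
  AEEqFun.coeFn_mk _ _

/-- The truncation `P_T x`, equal to `x` on `[0, T]` and to `0` on `(T, ∞)`. -/
def L2e.trunc {n : ℕ} (T : ℝ) (x : L2e n) : L2e n :=
  L2e.mk ((Icc 0 T).indicator x.val) fun S => (x.2 S).indicator measurableSet_Icc

/-- A system `S` is causal if `P_T S = P_T S P_T` for all `T > 0`. -/
def IsCausal {n m : ℕ} (S : L2e n → L2e m) : Prop :=
  ∀ T : ℝ, 0 < T → ∀ x : L2e n, (S x).trunc T = (S (x.trunc T)).trunc T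

/-- A system is bounded (stable) if its induced `L₂`-gain is finite. -/
def IsBoundedSystem {n m : ℕ} (S : L2e n → L2e m) : Prop :=
  ∃ γ : ℝ≥0, ∀ x : L2e n, x.InL2 → (S x).norm2 ≤ γ * x.norm2

/-! ### Fourier transforms -/

/-- The `i`-th component of a signal, extended by zero to the negative time axis. -/
def L2e.comp {n : ℕ} (x : L2e n) (i : Fin n) (t : ℝ) : ℂ :=
  (Ici (0 : ℝ)).indicator (fun t => ((x.val t i : ℝ) : ℂ)) t

lemma L2e.memLp_comp {n : ℕ} {x : L2e n} (hx : x.InL2) (i : Fin n) :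
    MemLp (x.comp i) 2 volume := by
  have h1 : MemLp x.val 2 halfLine := ⟨x.1.aestronglyMeasurable, hx⟩
  have h2 : MemLp (fun t => ((x.val t i : ℝ) : ℂ)) 2 halfLine := by
    refine h1.of_le ?_ (Filter.Eventually.of_forall fun t => ?_)
    · exact (Complex.continuous_ofReal.comp
        (EuclideanSpace.proj (𝕜 := ℝ) i).continuous).comp_aestronglyMeasurable h1.1
    · rw [Complex.norm_real]
      exact PiLp.norm_apply_le (x.val t) i
  exact (memLp_indicator_iff_restrict measurableSet_Ici).2 h2

/-- The value `x̂(iω) = ∫ x(t) e^{-iωt} dt` of the Fourier transform of `x ∈ L₂ⁿ`; as Mathlib's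
`𝓕 f (ξ)` has the kernel `e^{-2πiξt}`, it is evaluated at `ξ = ω / (2π)`. -/
def L2e.hat {n : ℕ} (x : L2e n) (hx : x.InL2) (ω : ℝ) (i : Fin n) : ℂ :=
  (𝓕 ((L2e.memLp_comp hx i).toLp (x.comp i)) : Lp ℂ 2 (volume : Measure ℝ)) (ω / (2 * Real.pi))

/-! ### Linear time-invariant systems -/

/-- All eigenvalues have negative real part. -/
def IsHurwitz {σ : Type} [Fintype σ] [DecidableEq σ] (A : Matrix σ σ ℝ) : Prop :=
  ∀ s ∈ spectrum ℂ (A.map Complex.ofReal), s.re < 0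

/-- The value `C (s I - A)⁻¹ B + D` of the transfer matrix of `(A, B, C, D)`. -/
def transferMatrix {σ ι κ : Type} [Fintype σ] [DecidableEq σ]
    (A : Matrix σ σ ℝ) (B : Matrix σ ι ℝ) (C : Matrix κ σ ℝ) (D : Matrix κ ι ℝ) (s : ℂ) :
    Matrix κ ι ℂ :=
  C.map Complex.ofReal * (s • (1 : Matrix σ σ ℂ) - A.map Complex.ofReal)⁻¹ * B.map Complex.ofReal
    + D.map Complex.ofReal

/-- `ξ` solves `ξ' = A ξ + B u` on `[0, ∞)`, `ξ 0 = 0`, in the sense of Carathéodory. -/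
def IsStateTrajectory {σ ι : Type} [Fintype σ] [Fintype ι] (A : Matrix σ σ ℝ) (B : Matrix σ ι ℝ)
    (u : ℝ → ι → ℝ) (ξ : ℝ → σ → ℝ) : Prop :=
  ContinuousOn ξ (Ici 0) ∧ ∀ t : ℝ, 0 ≤ t → ξ t = ∫ τ in (0 : ℝ)..t, (A *ᵥ ξ τ + B *ᵥ u τ)

/-- The value at `s` of a matrix of real rational functions. -/
def evalMatrix {ι κ : Type} (H : Matrix κ ι (RatFunc ℝ)) (s : ℂ) : Matrix κ ι ℂ :=
  H.map (RatFunc.eval Complex.ofRealHom s)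

/-- `H ∈ RH_∞`: all entries are proper and have no pole in the closed right half-plane. -/
def IsRHInfty {ι κ : Type} (H : Matrix κ ι (RatFunc ℝ)) : Prop :=
  ∀ i j, (H i j).num.natDegree ≤ (H i j).denom.natDegree ∧
    ∀ s : ℂ, 0 ≤ s.re → (H i j).denom.eval₂ Complex.ofRealHom s ≠ 0

/-- A realization `H = (A, B, C, D)` with Hurwitz matrix `A`. -/
structure StableRealization {ι κ : Type} (H : Matrix κ ι (RatFunc ℝ)) where
  n : ℕ
  A : Matrix (Fin n) (Fin n) ℝ
  B : Matrix (Fin n) ι ℝ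
  C : Matrix κ (Fin n) ℝ
  D : Matrix κ ι ℝ
  hurwitz : IsHurwitz A
  transfer_eq : ∀ s : ℂ, 0 ≤ s.re → evalMatrix H s = transferMatrix A B C D s

lemma exists_fundamentalMatrix {σ : Type} [Fintype σ] [DecidableEq σ] (A : Matrix σ σ ℝ) :
    ∃ E F : ℝ → Matrix σ σ ℝ, E 0 = 1 ∧ (∀ t, E t * F t = 1) ∧
      (∀ i j, Continuous fun t => F t i j) ∧
      (∀ i j t, HasDerivAt (fun t => E t i j) ((A * E t) i j) t) := by
  let _ : NormedRing (Matrix σ σ ℝ) := Matrix.linftyOpNormedRing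
  let _ : NormedAlgebra ℝ (Matrix σ σ ℝ) := Matrix.linftyOpNormedAlgebra
  have hd : ∀ (M : Matrix σ σ ℝ) (i j) (t : ℝ),
      HasDerivAt (fun t : ℝ => NormedSpace.exp (t • M) i j)
        ((M * NormedSpace.exp (t • M)) i j) t := fun M i j t => by
    have h := hasDerivAt_exp_smul_const' (𝕂 := ℝ) M t
    let L : Matrix σ σ ℝ →L[ℝ] ℝ := LinearMap.toContinuousLinearMap
      (Matrix.entryLinearMap ℝ ℝ i j)
    exact (L.hasFDerivAt.comp_hasDerivAt t h)
  refine ⟨fun t => NormedSpace.exp (t • A), fun t => NormedSpace.exp (t • (-A)), ?_, ?_, ?_, ?_⟩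
  · simp
  · intro t
    dsimp only
    rw [← Matrix.exp_add_of_commute]
    · simp
    · exact ((Commute.refl A).neg_right.smul_left t).smul_right t
  · exact fun i j => continuous_iff_continuousAt.2 fun t => (hd (-A) i j t).continuousAt
  · exact hd A

lemma integrableOn_pi {ι : Type} [Fintype ι] {f : ℝ → ι → ℝ} {s : Set ℝ}
    (h : ∀ i, IntegrableOn (fun t => f t i) s) : IntegrableOn f s :=
  Integrable.of_eval h

/-- Linear systems have state trajectories for all locally integrable inputs. -/
lemma exists_isStateTrajectory {σ ι : Type} [Fintype σ] [Fintype ι] (A : Matrix σ σ ℝ)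
    (B : Matrix σ ι ℝ) (u : ℝ → ι → ℝ) (hu : ∀ T : ℝ, IntegrableOn u (Icc 0 T)) :
    ∃ ξ, IsStateTrajectory A B u ξ := by
  classical
  obtain ⟨E, F, hE0, hEF, hF, hE⟩ := exists_fundamentalMatrix A
  have hui : ∀ T i, IntegrableOn (fun t => u t i) (Icc 0 T) := fun T i => (hu T).eval i
  have hBu : ∀ T i, IntegrableOn (fun t => (B *ᵥ u t) i) (Icc 0 T) := fun T i => by
    simp only [Matrix.mulVec, dotProduct]
    exact integrable_finsetSum _ fun j _ => (hui T j).const_mul _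
  have hf : ∀ T j, IntegrableOn (fun t => (F t *ᵥ (B *ᵥ u t)) j) (Icc 0 T) := fun T j => by
    change IntegrableOn (fun t => ∑ k, F t j k * (B *ᵥ u t) k) (Icc 0 T)
    refine integrable_finsetSum _ fun k _ => ?_
    exact (hBu T k).continuousOn_mul (hF j k).continuousOn isCompact_Icc
  have hfI : ∀ T : ℝ, 0 ≤ T → ∀ j,
      IntervalIntegrable (fun t => (F t *ᵥ (B *ᵥ u t)) j) volume 0 T := fun T hT j =>
    (intervalIntegrable_iff_integrableOn_Icc_of_le hT).2 (hf T j)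
  let g : ℝ → σ → ℝ := fun t j => ∫ τ in (0 : ℝ)..t, (F τ *ᵥ (B *ᵥ u τ)) j
  have hgac : ∀ T : ℝ, 0 ≤ T → ∀ j, AbsolutelyContinuousOnInterval (fun t => g t j) 0 T :=
    fun T hT j => (hfI T hT j).absolutelyContinuousOnInterval_intervalIntegral (by simp)
  have hEac : ∀ T : ℝ, ∀ i j, AbsolutelyContinuousOnInterval (fun t => E t i j) 0 T :=
    fun T i j => by
      have hc : ∀ k l, Continuous fun t => E t k l := fun k l =>
        continuous_iff_continuousAt.2 fun t => (hE k l t).continuousAt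
      have h1 : ContDiff ℝ 1 (fun t => E t i j) := by
        rw [contDiff_one_iff_deriv]
        refine ⟨fun t => (hE i j t).differentiableAt, ?_⟩
        have : deriv (fun t => E t i j) = fun t => (A * E t) i j :=
          funext fun t => (hE i j t).deriv
        rw [this]
        simp only [Matrix.mul_apply]
        exact continuous_finsetSum _ fun k _ => (hc k j).const_mul _
      exact h1.contDiffOn.absolutelyContinuousOnInterval
  have hsum : ∀ T : ℝ, 0 ≤ T → ∀ (i : σ) (s : Finset σ),
      AbsolutelyContinuousOnInterval (fun t => ∑ j ∈ s, E t i j * g t j) 0 T := by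
    intro T hT i s
    induction s using Finset.induction_on with
    | empty =>
      have h1 : ContDiff ℝ 1 fun _ : ℝ => (0 : ℝ) := contDiff_const
      simpa using h1.contDiffOn.absolutelyContinuousOnInterval (a := 0) (b := T)
    | insert j s hj ih =>
      simp only [Finset.sum_insert hj]
      exact ((hEac T i j).fun_mul (hgac T hT j)).fun_add ih
  have hxac : ∀ T : ℝ, 0 ≤ T → ∀ i,
      AbsolutelyContinuousOnInterval (fun t => (E t *ᵥ g t) i) 0 T := fun T hT i =>
    hsum T hT i Finset.univ
  have hxc : ∀ T : ℝ, 0 ≤ T → ContinuousOn (fun t => E t *ᵥ g t) (Icc 0 T) := fun T hT =>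
    continuousOn_pi.2 fun i => by simpa [uIcc_of_le hT] using (hxac T hT i).continuousOn
  refine ⟨fun t => E t *ᵥ g t, ?_, ?_⟩
  · intro t ht
    have h := hxc (t + 1) (by linarith [mem_Ici.1 ht]) t ⟨ht, by linarith⟩
    refine h.mono_of_mem_nhdsWithin ?_
    exact inter_mem_nhdsWithin _ (Iic_mem_nhds (by linarith))
  · intro T hT
    have hint : IntegrableOn (fun τ => A *ᵥ (E τ *ᵥ g τ) + B *ᵥ u τ) (Icc 0 T) := by
      refine Integrable.add ?_ (integrableOn_pi (hBu T))
      refine ContinuousOn.integrableOn_compact isCompact_Icc ?_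
      exact (Continuous.matrix_mulVec continuous_const continuous_id).comp_continuousOn (hxc T hT)
    ext i
    have hev : (∫ τ in (0 : ℝ)..T, (A *ᵥ (E τ *ᵥ g τ) + B *ᵥ u τ)) i =
        ∫ τ in (0 : ℝ)..T, (A *ᵥ (E τ *ᵥ g τ) + B *ᵥ u τ) i :=
      ((ContinuousLinearMap.proj (R := ℝ) (φ := fun _ : σ => ℝ) i).intervalIntegral_comp_comm
        ((intervalIntegrable_iff_integrableOn_Icc_of_le hT).2 hint)).symm
    rw [hev]
    have h0 : (E 0 *ᵥ g 0) i = 0 := by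
      have : g 0 = 0 := by ext j; simp [g]
      rw [this]; simp
    have hftc := (hxac T hT i).integral_deriv_eq_sub
    rw [h0, sub_zero] at hftc
    refine hftc.symm.trans ?_
    refine intervalIntegral.integral_congr_ae ?_
    have hae : ∀ᵐ t, ∀ j, t ∈ uIcc 0 T →
        HasDerivAt (fun t => g t j) ((F t *ᵥ (B *ᵥ u t)) j) t := by
      rw [ae_all_iff]
      intro j
      filter_upwards [(hfI T hT j).ae_hasDerivAt_integral] with t ht ht'
      exact ht ht' 0 (by simp)
    filter_upwards [hae] with t ht ht'
    have ht'' := uIoc_subset_uIcc ht'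
    have hd : HasDerivAt (fun t => (E t *ᵥ g t) i)
        (∑ j, ((A * E t) i j * g t j + E t i j * (F t *ᵥ (B *ᵥ u t)) j)) t := by
      have := HasDerivAt.fun_sum (u := Finset.univ)
        fun j (_ : j ∈ Finset.univ) => (hE i j t).mul (ht j ht'')
      exact this
    rw [hd.deriv, Finset.sum_add_distrib]
    have e1 : ∑ j, (A * E t) i j * g t j = (A *ᵥ (E t *ᵥ g t)) i := by
      rw [Matrix.mulVec_mulVec]; rfl
    have e2 : ∑ j, E t i j * (F t *ᵥ (B *ᵥ u t)) j = (B *ᵥ u t) i := by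
      have : (E t *ᵥ (F t *ᵥ (B *ᵥ u t))) i = (B *ᵥ u t) i := by
        rw [Matrix.mulVec_mulVec, hEF, Matrix.one_mulVec]
      exact this
    rw [e1, e2]; rfl

/-- Matrices in `RH_∞` have realizations with Hurwitz state matrices. -/
lemma nonempty_stableRealization {p m : ℕ} {H : Matrix (Fin p) (Fin m) (RatFunc ℝ)}
    (hH : IsRHInfty H) : Nonempty (StableRealization H) := by
  classical
  -- a common denominator `q` and the numerators `P i j`
  let S : Finset (Fin p × Fin m) := Finset.univ
  let q : Polynomial ℝ := ∏ a ∈ S, (H a.1 a.2).denom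
  have hqm : q.Monic := Polynomial.monic_prod_of_monic _ _ fun a _ => RatFunc.monic_denom _
  have hq0 : ∀ s : ℂ, 0 ≤ s.re → q.eval₂ Complex.ofRealHom s ≠ 0 := fun s hs => by
    rw [Polynomial.eval₂_finsetProd]
    exact Finset.prod_ne_zero_iff.2 fun a _ => (hH a.1 a.2).2 s hs
  let r : Fin p → Fin m → Polynomial ℝ := fun i j => ∏ a ∈ S.erase (i, j), (H a.1 a.2).denom
  have hr : ∀ i j, (H i j).denom * r i j = q := fun i j =>
    Finset.mul_prod_erase S (fun a => (H a.1 a.2).denom) (a := (i, j)) (Finset.mem_univ _)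
  have hrm : ∀ i j, (r i j).Monic := fun i j =>
    Polynomial.monic_prod_of_monic _ _ fun a _ => RatFunc.monic_denom _
  let P : Fin p → Fin m → Polynomial ℝ := fun i j => (H i j).num * r i j
  let d := q.natDegree
  have hPd : ∀ i j, (P i j).natDegree ≤ d := fun i j => by
    have h1 : d = (H i j).denom.natDegree + (r i j).natDegree := by
      rw [← (RatFunc.monic_denom (H i j)).natDegree_mul (hrm i j), hr]
    have h2 := Polynomial.natDegree_mul_le (p := (H i j).num) (q := r i j)
    have h3 := (hH i j).1
    change ((H i j).num * r i j).natDegree ≤ d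
    omega
  have hev : ∀ i j (s : ℂ), 0 ≤ s.re → RatFunc.eval Complex.ofRealHom s (H i j) =
      (P i j).eval₂ Complex.ofRealHom s / q.eval₂ Complex.ofRealHom s := fun i j s hs => by
    have h1 : (r i j).eval₂ Complex.ofRealHom s ≠ 0 := fun h0 => by
      apply hq0 s hs
      rw [← hr i j, Polynomial.eval₂_mul, h0, mul_zero]
    rw [← hr i j]
    simp only [P, Polynomial.eval₂_mul]
    rw [mul_div_mul_right _ _ h1]
    rfl
  -- evaluation of polynomials of degree at most `d`
  have hsumd : ∀ (f : Polynomial ℝ), f.natDegree ≤ d → ∀ s : ℂ,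
      f.eval₂ Complex.ofRealHom s =
        ∑ k : Fin d, (f.coeff k : ℂ) * s ^ (k : ℕ) + (f.coeff d : ℂ) * s ^ d := by
    intro f hf s
    rw [Polynomial.eval₂_eq_sum_range' _ (Nat.lt_succ_of_le hf), Finset.sum_range_succ,
      Finset.sum_range]
    rfl
  have hqs : ∀ s : ℂ, q.eval₂ Complex.ofRealHom s =
      ∑ k : Fin d, (q.coeff k : ℂ) * s ^ (k : ℕ) + s ^ d := fun s => by
    rw [hsumd q le_rfl s, hqm.coeff_natDegree]; simp
  -- the block companion realization
  let e : Fin m × Fin d ≃ Fin (m * d) := finProdFinEquiv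
  let K : Matrix (Fin d) (Fin d) ℝ := Matrix.of fun k l =>
    if (k : ℕ) + 1 < d then (if (l : ℕ) = k + 1 then 1 else 0) else -q.coeff l
  let A : Matrix (Fin m × Fin d) (Fin m × Fin d) ℝ := Matrix.of fun a b =>
    if a.1 = b.1 then K a.2 b.2 else 0
  let B : Matrix (Fin m × Fin d) (Fin m) ℝ := Matrix.of fun a j =>
    if a.1 = j ∧ (a.2 : ℕ) + 1 = d then 1 else 0
  let D : Matrix (Fin p) (Fin m) ℝ := Matrix.of fun i j => (P i j).coeff d
  let C : Matrix (Fin p) (Fin m × Fin d) ℝ := Matrix.of fun i a =>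
    (P i a.1).coeff a.2 - (P i a.1).coeff d * q.coeff a.2
  have hKmul : ∀ (x : Fin d → ℂ) (k : Fin d), (K.map Complex.ofReal *ᵥ x) k =
      if h : (k : ℕ) + 1 < d then x ⟨k + 1, h⟩ else -∑ l : Fin d, (q.coeff l : ℂ) * x l := by
    intro x k
    simp only [Matrix.mulVec, dotProduct, Matrix.map_apply, K, Matrix.of_apply]
    split_ifs with h
    · rw [Finset.sum_eq_single ⟨k + 1, h⟩]
      · simp
      · intro b _ hb
        have : (b : ℕ) ≠ k + 1 := fun h' => hb (Fin.ext h')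
        simp [this]
      · simp
    · rw [← Finset.sum_neg_distrib]
      exact Finset.sum_congr rfl fun l _ => by push_cast; ring
  have hAmul : ∀ (x : Fin m × Fin d → ℂ) (j : Fin m) (k : Fin d),
      (A.map Complex.ofReal *ᵥ x) (j, k) = (K.map Complex.ofReal *ᵥ fun l => x (j, l)) k := by
    intro x j k
    simp only [Matrix.mulVec, dotProduct, Matrix.map_apply, A, Matrix.of_apply]
    rw [Fintype.sum_prod_type, Finset.sum_eq_single j]
    · simp
    · intro b _ hb
      simp [Ne.symm hb]
    · simp
  -- away from the zeros of `q`, the matrix `s I - A` is injective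
  have hinj : ∀ s : ℂ, q.eval₂ Complex.ofRealHom s ≠ 0 → ∀ x : Fin m × Fin d → ℂ,
      A.map Complex.ofReal *ᵥ x = s • x → x = 0 := by
    intro s hs x hx
    have hx' : ∀ j k, (K.map Complex.ofReal *ᵥ fun l => x (j, l)) k = s * x (j, k) :=
      fun j k => by rw [← hAmul, hx]; rfl
    funext ⟨j, k⟩
    have hd : 0 < d := k.pos
    have hpow : ∀ (n : ℕ) (hn : n < d), x (j, ⟨n, hn⟩) = s ^ n * x (j, ⟨0, hd⟩) := by
      intro n
      induction n with
      | zero => intro hn; simp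
      | succ n ih =>
        intro hn
        have h1 := hx' j ⟨n, by omega⟩
        rw [hKmul, dif_pos hn, ih (by omega)] at h1
        rw [h1]; ring
    have hlast := hx' j ⟨d - 1, by omega⟩
    rw [hKmul, dif_neg (by simp; omega), hpow (d - 1)] at hlast
    have h2 : ∑ l : Fin d, (q.coeff l : ℂ) * x (j, l) =
        (∑ l : Fin d, (q.coeff l : ℂ) * s ^ (l : ℕ)) * x (j, ⟨0, hd⟩) := by
      rw [Finset.sum_mul]
      exact Finset.sum_congr rfl fun l _ => by rw [hpow l l.2]; ring
    have h3 : q.eval₂ Complex.ofRealHom s * x (j, ⟨0, hd⟩) = 0 := by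
      rw [hqs, add_mul, ← h2]
      have h4 : s ^ d = s * s ^ (d - 1) := by rw [← pow_succ']; congr 1; omega
      rw [h4]; linear_combination -hlast
    have h5 := (mul_eq_zero.1 h3).resolve_left hs
    have h6 := hpow k k.2
    rw [h5, mul_zero] at h6
    simpa using h6
  have hunit : ∀ s : ℂ, q.eval₂ Complex.ofRealHom s ≠ 0 →
      IsUnit (s • (1 : Matrix (Fin m × Fin d) (Fin m × Fin d) ℂ) - A.map Complex.ofReal) := by
    intro s hs
    rw [← Matrix.mulVec_injective_iff_isUnit]
    intro x y hxy
    have h1 := hinj s hs (x - y) (by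
      have h2 : (s • (1 : Matrix (Fin m × Fin d) (Fin m × Fin d) ℂ) - A.map Complex.ofReal) *ᵥ
          (x - y) = 0 := by rw [Matrix.mulVec_sub]; exact sub_eq_zero.2 hxy
      rw [Matrix.sub_mulVec, Matrix.smul_mulVec, Matrix.one_mulVec] at h2
      exact (sub_eq_zero.1 h2).symm)
    exact sub_eq_zero.1 h1
  have hmapA : ∀ (f : Matrix (Fin m × Fin d) (Fin m × Fin d) ℂ), (f.submatrix e.symm e.symm) =
      Matrix.reindexAlgEquiv ℂ ℂ e f := fun f => rfl
  refine ⟨⟨m * d, A.submatrix e.symm e.symm, B.submatrix e.symm id, C.submatrix id e.symm, D,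
    ?_, ?_⟩⟩
  · intro s hs
    by_contra hre
    have h1 : (A.submatrix e.symm e.symm).map Complex.ofReal =
      Matrix.reindexAlgEquiv ℂ ℂ e (A.map Complex.ofReal) := rfl
    rw [h1, AlgEquiv.spectrum_eq, spectrum.mem_iff] at hs
    apply hs
    have h2 := hunit s (hq0 s (not_lt.1 hre))
    rwa [Algebra.algebraMap_eq_smul_one]
  · intro s hs
    have hs0 := hq0 s hs
    let R : Matrix (Fin m × Fin d) (Fin m × Fin d) ℂ := s • 1 - A.map Complex.ofReal
    have hR : IsUnit R := hunit s hs0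
    have hRdet := (Matrix.isUnit_iff_isUnit_det _).1 hR
    -- `(s I - A) V = q(s) B`
    let V : Matrix (Fin m × Fin d) (Fin m) ℂ := Matrix.of fun a j =>
      if a.1 = j then s ^ (a.2 : ℕ) else 0
    have hRV : R * V = q.eval₂ Complex.ofRealHom s • B.map Complex.ofReal := by
      ext ⟨j', k⟩ j
      have h1 : (R * V) (j', k) j = s * V (j', k) j -
          (A.map Complex.ofReal *ᵥ fun a => V a j) (j', k) := by
        simp only [R, Matrix.sub_mul, Matrix.smul_mul, Matrix.one_mul, Matrix.sub_apply,
          Matrix.smul_apply, smul_eq_mul]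
        rfl
      rw [h1, hAmul, hKmul]
      simp only [V, B, Matrix.of_apply, Matrix.smul_apply, Matrix.map_apply, smul_eq_mul]
      by_cases hj : j' = j
      · by_cases hk : (k : ℕ) + 1 < d
        · have hk' : ¬ ((k : ℕ) + 1 = d) := by omega
          simp [hj, hk, hk', pow_succ']
        · have hk' : (k : ℕ) + 1 = d := by omega
          have h4 : s ^ d = s * s ^ (k : ℕ) := by rw [← pow_succ', hk']
          rw [hqs, h4]
          simp [hj, hk']
          ring
      · by_cases hk : (k : ℕ) + 1 < d <;> simp [hj, hk]
    have hRB : R⁻¹ * B.map Complex.ofReal = (q.eval₂ Complex.ofRealHom s)⁻¹ • V := by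
      have h1 : B.map Complex.ofReal = R * ((q.eval₂ Complex.ofRealHom s)⁻¹ • V) := by
        rw [Matrix.mul_smul, hRV, smul_smul, inv_mul_cancel₀ hs0, one_smul]
      rw [h1, Matrix.nonsing_inv_mul_cancel_left _ _ hRdet]
    have htm : transferMatrix (A.submatrix e.symm e.symm) (B.submatrix e.symm id)
        (C.submatrix id e.symm) D s =
        C.map Complex.ofReal * R⁻¹ * B.map Complex.ofReal + D.map Complex.ofReal := by
      have h1 : s • (1 : Matrix (Fin (m * d)) (Fin (m * d)) ℂ) -
          (A.submatrix e.symm e.symm).map Complex.ofReal = R.submatrix e.symm e.symm := by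
        ext a b
        simp [R, Matrix.one_apply]
      unfold transferMatrix
      rw [h1, Matrix.inv_submatrix_equiv]
      have h2 : (C.submatrix id e.symm).map Complex.ofReal =
        (C.map Complex.ofReal).submatrix id e.symm := rfl
      have h3 : (B.submatrix e.symm id).map Complex.ofReal =
        (B.map Complex.ofReal).submatrix e.symm id := rfl
      rw [h2, h3, Matrix.submatrix_mul_equiv, Matrix.submatrix_mul_equiv, Matrix.submatrix_id_id]
    rw [htm, Matrix.mul_assoc, hRB]
    ext i j
    simp only [evalMatrix, Matrix.map_apply, Matrix.add_apply, Matrix.mul_smul,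
      Matrix.smul_apply, smul_eq_mul, hev i j s hs]
    have hCV : (C.map Complex.ofReal * V) i j =
        ∑ k : Fin d, ((P i j).coeff k - (P i j).coeff d * q.coeff k : ℂ) * s ^ (k : ℕ) := by
      simp only [Matrix.mul_apply, Matrix.map_apply, C, V, Matrix.of_apply]
      rw [Fintype.sum_prod_type, Finset.sum_eq_single j]
      · simp
      · intro b _ hb
        simp [hb]
      · simp
    rw [hCV, hsumd _ (hPd i j) s]
    simp only [D, Matrix.of_apply, sub_mul, Finset.sum_sub_distrib]
    have h7 : ∑ k : Fin d, ((P i j).coeff d : ℂ) * (q.coeff k : ℂ) * s ^ (k : ℕ) =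
        (P i j).coeff d * (q.eval₂ Complex.ofRealHom s - s ^ d) := by
      rw [hqs, add_sub_cancel_right, Finset.mul_sum]
      exact Finset.sum_congr rfl fun k _ => by ring
    rw [h7]
    field_simp
    ring

lemma L2e.integrableOn {n : ℕ} (x : L2e n) (T : ℝ) :
    IntegrableOn (fun t => (x.val t).ofLp) (Icc 0 T) := by
  have h : Integrable x.val (volume.restrict (Icc 0 T)) := (x.2 T).integrable (by norm_num)
  exact (EuclideanSpace.equiv (Fin n) ℝ).toContinuousLinearMap.integrable_comp h

/-- The output `z = C ξ + D w` of `ξ' = A ξ + B w`, `ξ 0 = 0`. -/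
def IsOutput {n m p : ℕ} (A : Matrix (Fin n) (Fin n) ℝ) (B : Matrix (Fin n) (Fin m) ℝ)
    (C : Matrix (Fin p) (Fin n) ℝ) (D : Matrix (Fin p) (Fin m) ℝ) (w : L2e m) (z : L2e p) : Prop :=
  ∃ ξ : ℝ → Fin n → ℝ, IsStateTrajectory A B (fun t => (w.val t).ofLp) ξ ∧
    ∀ᵐ t ∂halfLine, (z.val t).ofLp = C *ᵥ ξ t + D *ᵥ (w.val t).ofLp

lemma exists_isOutput {n m p : ℕ} (A : Matrix (Fin n) (Fin n) ℝ) (B : Matrix (Fin n) (Fin m) ℝ)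
    (C : Matrix (Fin p) (Fin n) ℝ) (D : Matrix (Fin p) (Fin m) ℝ) (w : L2e m) :
    ∃ z : L2e p, IsOutput A B C D w z := by
  obtain ⟨ξ, hξ⟩ := exists_isStateTrajectory A B _ w.integrableOn
  have hf : ∀ T : ℝ, MemLp (fun t => WithLp.toLp 2 (C *ᵥ ξ t + D *ᵥ (w.val t).ofLp) :
      ℝ → EuclideanSpace ℝ (Fin p)) 2 (volume.restrict (Icc 0 T)) := fun T => by
    have h1 : MemLp (fun t => WithLp.toLp 2 (C *ᵥ ξ t) : ℝ → EuclideanSpace ℝ (Fin p)) 2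
        (volume.restrict (Icc 0 T)) := by
      have hc : ContinuousOn
          (fun t => WithLp.toLp 2 (C *ᵥ ξ t) : ℝ → EuclideanSpace ℝ (Fin p)) (Icc 0 T) := by
        refine ((PiLp.continuous_toLp 2 _).comp
          (Continuous.matrix_mulVec continuous_const continuous_id)).comp_continuousOn
          (hξ.1.mono Icc_subset_Ici_self)
      obtain ⟨c, hcb⟩ := isCompact_Icc.exists_bound_of_continuousOn hc
      exact MemLp.of_bound (hc.aestronglyMeasurable measurableSet_Icc) c
        ((ae_restrict_mem measurableSet_Icc).mono hcb)
    have h2 : MemLp (fun t => (Matrix.toEuclideanLin D).toContinuousLinearMap (w.val t)) 2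
        (volume.restrict (Icc 0 T)) :=
      (Matrix.toEuclideanLin D).toContinuousLinearMap.comp_memLp' (w.2 T)
    exact h1.add h2
  refine ⟨L2e.mk _ hf, ξ, hξ, ?_⟩
  filter_upwards [L2e.val_mk _ hf] with t ht
  rw [ht]

/-- The system `H : L_{2e}^m → L_{2e}^p` with transfer matrix `H ∈ RH_∞`: the input-output map of a
realization of `H` with Hurwitz state matrix. -/
def ioMap {m p : ℕ} (H : Matrix (Fin p) (Fin m) (RatFunc ℝ)) (hH : IsRHInfty H)
    (w : L2e m) : L2e p :=
  let r := Classical.choice (nonempty_stableRealization hH)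
  Classical.choose (exists_isOutput r.A r.B r.C r.D w)

/-! ### Multipliers and integral quadratic constraints -/

/-- The multiplier `Π(iω) = Ψ(iω)^* M Ψ(iω)` for `Ψ = (A, B, C, D)`. -/
def multiplier {σ ι κ : Type} [Fintype σ] [DecidableEq σ] [Fintype κ]
    (A : Matrix σ σ ℝ) (B : Matrix σ ι ℝ) (C : Matrix κ σ ℝ) (D : Matrix κ ι ℝ)
    (M : Matrix κ κ ℝ) (ω : ℝ) : Matrix ι ι ℂ :=
  (transferMatrix A B C D (Complex.I * ω))ᴴ * M.map Complex.ofReal *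
    transferMatrix A B C D (Complex.I * ω)

/-- `Δ` satisfies the integral quadratic constraint `∫ û^* Π û dω ≥ 0`, `û = col(ẑ, Δ(z)^)`, for all
`z ∈ L₂`. (For bounded `Δ` the signal `Δ(z)` is always in `L₂`; the integrand is real if `Π` is
Hermitian.) -/
def SatisfiesIQC {p m : ℕ} (Δ : L2e p → L2e m)
    (Pi : ℝ → Matrix (Fin p ⊕ Fin m) (Fin p ⊕ Fin m) ℂ) : Prop :=
  ∀ (z : L2e p) (hz : z.InL2) (hw : (Δ z).InL2),
    0 ≤ ∫ ω : ℝ, (star (Sum.elim (z.hat hz ω) ((Δ z).hat hw ω)) ⬝ᵥ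
      (Pi ω *ᵥ Sum.elim (z.hat hz ω) ((Δ z).hat hw ω))).re

/-- The frequency domain inequality `col(H, I)^* Π col(H, I) ⪯ 0` on the imaginary axis. (For
continuous `H` and `Π` on the extended imaginary axis it then also holds at `∞`.) -/
def SatisfiesFDI {p m : ℕ} (H : Matrix (Fin p) (Fin m) (RatFunc ℝ))
    (Pi : ℝ → Matrix (Fin p ⊕ Fin m) (Fin p ⊕ Fin m) ℂ) : Prop :=
  ∀ ω : ℝ,
    let F : Matrix (Fin p ⊕ Fin m) (Fin m) ℂ :=
      Matrix.fromRows (evalMatrix H (Complex.I * ω)) (1 : Matrix (Fin m) (Fin m) ℂ)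
    (-(Fᴴ * Pi ω * F)).PosSemidef

/-- The symmetric matrix `Z` certifies that `Π = Ψ^* M Ψ` with `Ψ = (A, B, C, D)` has a canonical
factorization: for some symmetric `M'`, some `C'` and some invertible `D'`,
`[I 0; A B; C D]ᵀ [0 Z 0; Z 0 0; 0 0 M] [I 0; A B; C D] = [C' D']ᵀ M' [C' D']`
and `A - B D'⁻¹ C'` is Hurwitz. If `A` is Hurwitz, then `Ψ^* M Ψ = Ψ'^* M' Ψ'` for
`Ψ' = (A, B, C', D')`, and both `Ψ'` and `Ψ'⁻¹` are in `RH_∞`. -/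
def CertifiesCanonicalFactorization {σ ι κ : Type} [Fintype σ] [DecidableEq σ] [Fintype ι]
    [DecidableEq ι] [Fintype κ]
    (A : Matrix σ σ ℝ) (B : Matrix σ ι ℝ) (C : Matrix κ σ ℝ) (D : Matrix κ ι ℝ)
    (M : Matrix κ κ ℝ) (Z : Matrix σ σ ℝ) : Prop :=
  Z.IsSymm ∧ ∃ (M' : Matrix ι ι ℝ) (C' : Matrix ι σ ℝ) (D' : Matrix ι ι ℝ),
    M'.IsSymm ∧ IsUnit D'.det ∧
    Matrix.fromBlocks (Aᵀ * Z + Z * A + Cᵀ * M * C) (Z * B + Cᵀ * M * D)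
      (Bᵀ * Z + Dᵀ * M * C) (Dᵀ * M * D) =
      (Matrix.fromCols C' D')ᵀ * M' * Matrix.fromCols C' D' ∧
    IsHurwitz (A - B * D'⁻¹ * C')

/-- `Δ` satisfies a finite-horizon IQC with terminal cost matrix `Z = Zᵀ` with respect to the
factorization `Π = Ψ^* M Ψ`, `Ψ = (A, B, C, D)`: along the trajectories of the filter
`ξ' = A ξ + B u`, `ξ 0 = 0`, `y = C ξ + D u` driven by `u = col(z, Δ(z))`. -/
def SatisfiesFiniteHorizonIQC {σ κ : Type} [Fintype σ] [Fintype κ] {p m : ℕ}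
    (Δ : L2e p → L2e m)
    (A : Matrix σ σ ℝ) (B : Matrix σ (Fin p ⊕ Fin m) ℝ) (C : Matrix κ σ ℝ)
    (D : Matrix κ (Fin p ⊕ Fin m) ℝ) (M : Matrix κ κ ℝ) (Z : Matrix σ σ ℝ) : Prop :=
  Z.IsSymm ∧ ∀ (z : L2e p) (u : ℝ → Fin p ⊕ Fin m → ℝ) (ξ : ℝ → σ → ℝ) (y : ℝ → κ → ℝ),
    (u = fun t => Sum.elim (z.val t).ofLp ((Δ z).val t).ofLp) →
    IsStateTrajectory A B u ξ →
    (y = fun t => C *ᵥ ξ t + D *ᵥ u t) →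
    ∀ T : ℝ, 0 < T → 0 ≤ (∫ t in (0 : ℝ)..T, y t ⬝ᵥ (M *ᵥ y t)) + ξ T ⬝ᵥ (Z *ᵥ ξ T)

end

/-! Write `y'` for the output of the filter `(A, B, C', D')` and call `∫ y'ᵀ M' y'` the cost of an
input. Evaluated along trajectories, the certificate says that `y'ᵀ M' y'` is `yᵀ M y` plus the
derivative of `ξᵀ Z ξ`. Hence the claimed finite-horizon expression equals `∫₀ᵀ y'ᵀ M' y'`
(`intervalIntegral_dissipation`). For square integrable inputs the storage `ξᵀ Z ξ` starts at zero
and vanishes at infinity, so `M` and `M'` give the same infinite-horizon cost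
(`integral_dissipation`).

The inverse of the primed filter is stable. Therefore `u` on `[0, T]` can be continued to a square
integrable `v = col(zT, wT)` with `y' = 0` after `T` (`exists_extension`), and the finite-horizon
expression becomes the full cost of `v`. The soft IQC does not apply to `v`, since `wT` need not be
`Δ(zT)` after `T`. This is repaired by feedback: with `d = zT - H wT`, let `z'` solve `z' - H Δ(z')
= d`, and put `w' = Δ(z')`. Causality gives `z' = z` and `w' = Δ(z)` on `[0, T]`. Linearity of `H`
shows that `u' = col(z', w')` differs from `v` by `col(H e, e)`, where `e = w' - wT` vanishes on
`[0, T]`.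

The primed output of `v` lives on `[0, T]` and that of `col(H e, e)` on `(T, ∞)`. So there is no
cross term, and cost(`u'`) = cost(`v`) + cost(`col(H e, e)`). The left side is nonnegative by the
IQC (`SatisfiesIQC.integral_nonneg`) and the last term is nonpositive by the frequency domain
inequality (`SatisfiesFDI.integral_nonpos`), hence cost(`v`) ≥ 0. The analytic input is that Hurwitz
systems preserve `L₂` (`memLp_of_isHurwitz`) and that Parseval's identity turns quadratic costs of a
filter into frequency integrals (`integral_quadratic_output`). -/

/-! ### Primitives on the half line -/

/-- `x` is the primitive on `[0, ∞)` of the locally integrable function `x'` with `x 0 = 0`. -/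
def IsPrimitive {E : Type*} [NormedAddCommGroup E] [NormedSpace ℝ E] (x' x : ℝ → E) : Prop :=
  (∀ T : ℝ, IntegrableOn x' (Icc 0 T)) ∧ ∀ t : ℝ, 0 ≤ t → x t = ∫ τ in (0 : ℝ)..t, x' τ

namespace IsPrimitive

variable {E F : Type*} [NormedAddCommGroup E] [NormedSpace ℝ E] [NormedAddCommGroup F]
  [NormedSpace ℝ F] {x' y' x y : ℝ → E}

lemma intervalIntegrable (h : IsPrimitive x' x) {T : ℝ} (hT : 0 ≤ T) :
    IntervalIntegrable x' volume 0 T :=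
  (intervalIntegrable_iff_integrableOn_Icc_of_le hT).2 (h.1 T)

lemma congr (h : IsPrimitive x' x) (hx : x' =ᵐ[halfLine] y') : IsPrimitive y' x := by
  refine ⟨fun T => (h.1 T).congr (ae_Icc_of_ae_halfLine hx T), fun t ht => ?_⟩
  rw [h.2 t ht]
  refine intervalIntegral.integral_congr_ae ?_
  filter_upwards [(ae_restrict_iff' measurableSet_Ici).1 hx] with τ hτ hτt
  rw [uIoc_of_le ht] at hτt
  exact hτ hτt.1.le

lemma add (hx : IsPrimitive x' x) (hy : IsPrimitive y' y) :
    IsPrimitive (fun t => x' t + y' t) (fun t => x t + y t) := by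
  refine ⟨fun T => (hx.1 T).add (hy.1 T), fun t ht => ?_⟩
  beta_reduce
  rw [hx.2 t ht, hy.2 t ht,
    intervalIntegral.integral_add (hx.intervalIntegrable ht) (hy.intervalIntegrable ht)]

lemma sub (hx : IsPrimitive x' x) (hy : IsPrimitive y' y) :
    IsPrimitive (fun t => x' t - y' t) (fun t => x t - y t) := by
  refine ⟨fun T => (hx.1 T).sub (hy.1 T), fun t ht => ?_⟩
  beta_reduce
  rw [hx.2 t ht, hy.2 t ht,
    intervalIntegral.integral_sub (hx.intervalIntegrable ht) (hy.intervalIntegrable ht)]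

lemma clm_comp [CompleteSpace E] [CompleteSpace F] (L : E →L[ℝ] F) (hx : IsPrimitive x' x) :
    IsPrimitive (fun t => L (x' t)) (fun t => L (x t)) := by
  refine ⟨fun T => L.integrable_comp (hx.1 T), fun t ht => ?_⟩
  beta_reduce
  rw [hx.2 t ht, L.intervalIntegral_comp_comm (hx.intervalIntegrable ht)]

lemma const_mul {x' x : ℝ → ℝ} (c : ℝ) (hx : IsPrimitive x' x) :
    IsPrimitive (fun t => c * x' t) (fun t => c * x t) :=
  hx.clm_comp (c • ContinuousLinearMap.id ℝ ℝ)

lemma sum {ι : Type*} (s : Finset ι) {x' x : ι → ℝ → ℝ} (h : ∀ i ∈ s, IsPrimitive (x' i) (x i)) :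
    IsPrimitive (fun t => ∑ i ∈ s, x' i t) (fun t => ∑ i ∈ s, x i t) := by
  classical
  induction s using Finset.induction_on with
  | empty => exact ⟨fun T => by simp, fun t _ => by simp⟩
  | insert i s hi ih =>
    simp only [Finset.sum_insert hi]
    exact (h i (Finset.mem_insert_self i s)).add
      (ih fun j hj => h j (Finset.mem_insert_of_mem hj))

lemma continuousOn_Icc (hx : IsPrimitive x' x) {T : ℝ} (hT : 0 ≤ T) :
    ContinuousOn x (Icc 0 T) := by
  have h1 : ContinuousOn (fun t => ∫ τ in (0 : ℝ)..t, x' τ) (Icc 0 T) := by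
    have := intervalIntegral.continuousOn_primitive_interval (a := 0) (b := T) (f := x')
      (by rw [uIcc_of_le hT]; exact hx.1 T)
    rwa [uIcc_of_le hT] at this
  exact h1.congr fun t ht => hx.2 t ht.1

lemma memLp_Icc (hx : IsPrimitive x' x) {T : ℝ} (hT : 0 ≤ T) :
    MemLp x 2 (volume.restrict (Icc 0 T)) := by
  have hc := hx.continuousOn_Icc hT
  obtain ⟨c, hcb⟩ := isCompact_Icc.exists_bound_of_continuousOn hc
  exact MemLp.of_bound (hc.aestronglyMeasurable measurableSet_Icc) c
    ((ae_restrict_mem measurableSet_Icc).mono hcb)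

/-- The product rule. -/
lemma mul {x' y' x y : ℝ → ℝ} (hx : IsPrimitive x' x) (hy : IsPrimitive y' y) :
    IsPrimitive (fun t => x' t * y t + x t * y' t) (fun t => x t * y t) := by
  have hint : ∀ T : ℝ, 0 ≤ T → IntegrableOn (fun t => x' t * y t + x t * y' t) (Icc 0 T) :=
    fun T hT => ((hx.1 T).mul_continuousOn (hy.continuousOn_Icc hT) isCompact_Icc).add
      ((hy.1 T).continuousOn_mul (hx.continuousOn_Icc hT) isCompact_Icc)
  refine ⟨fun T => ?_, fun T hT => ?_⟩
  · rcases le_or_gt 0 T with hT | hT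
    · exact hint T hT
    · simp [Icc_eq_empty_of_lt hT]
  -- The derivatives `x'` and `y'` are merely locally integrable, so the product is differentiated
  -- as one of absolutely continuous functions, whose derivatives are identified almost everywhere
  -- by Lebesgue differentiation.
  · have hX := (hx.intervalIntegrable hT).absolutelyContinuousOnInterval_intervalIntegral (c := 0)
      (by simp)
    have hY := (hy.intervalIntegrable hT).absolutelyContinuousOnInterval_intervalIntegral (c := 0)
      (by simp)
    have h := hX.integral_deriv_mul_eq_sub hY
    rw [← hx.2 T hT, ← hy.2 T hT, intervalIntegral.integral_same, zero_mul, sub_zero] at h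
    beta_reduce
    rw [← h]
    refine intervalIntegral.integral_congr_ae ?_
    filter_upwards [(hx.intervalIntegrable hT).ae_hasDerivAt_integral,
      (hy.intervalIntegrable hT).ae_hasDerivAt_integral] with t h1 h2 ht
    have ht' := uIoc_subset_uIcc ht
    rw [uIoc_of_le hT] at ht
    rw [(h1 ht' 0 (by simp)).deriv, (h2 ht' 0 (by simp)).deriv, ← hx.2 t ht.1.le,
      ← hy.2 t ht.1.le]

end IsPrimitive

/-! ### Integrals over the half line and energy estimates -/

lemma integrableOn_halfLine_of_bounded {f : ℝ → ℝ} (hf : ∀ T : ℝ, IntegrableOn f (Icc 0 T))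
    (h0 : ∀ t, 0 ≤ f t) (K : ℝ) (hK : ∀ T : ℝ, 0 ≤ T → ∫ t in (0 : ℝ)..T, f t ≤ K) :
    Integrable f halfLine := by
  rw [halfLine, ← restrict_Ioi_eq_restrict_Ici]
  refine integrableOn_Ioi_of_intervalIntegral_norm_bounded K 0
    (fun i : ℝ => (hf i).mono_set Ioc_subset_Icc_self) Filter.tendsto_id ?_
  filter_upwards [Filter.eventually_ge_atTop 0] with T hT
  simpa only [Real.norm_eq_abs, abs_of_nonneg (h0 _), id] using hK T hT

lemma intervalIntegral_le_integral_halfLine {f : ℝ → ℝ} (hf : Integrable f halfLine)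
    (h0 : ∀ t, 0 ≤ f t) {T : ℝ} (hT : 0 ≤ T) : ∫ t in (0 : ℝ)..T, f t ≤ ∫ t, f t ∂halfLine := by
  rw [intervalIntegral.integral_of_le hT]
  exact setIntegral_mono_set hf (Filter.Eventually.of_forall h0)
    (Ioc_subset_Icc_self.trans Icc_subset_Ici_self).eventuallyLE

lemma tendsto_intervalIntegral_halfLine {f : ℝ → ℝ} (hf : Integrable f halfLine) :
    Filter.Tendsto (fun T => ∫ t in (0 : ℝ)..T, f t) Filter.atTop (nhds (∫ t, f t ∂halfLine)) := by
  have h := hf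
  rw [halfLine, ← restrict_Ioi_eq_restrict_Ici] at h ⊢
  exact intervalIntegral_tendsto_integral_Ioi 0 h Filter.tendsto_id

/-- An integrable primitive of an integrable function vanishes at infinity, so that the integral
of the derivative vanishes. -/
lemma IsPrimitive.integral_eq_zero {x' x : ℝ → ℝ} (h : IsPrimitive x' x)
    (hx' : Integrable x' halfLine) (hx : Integrable x halfLine) : ∫ t, x' t ∂halfLine = 0 := by
  have h1 : Filter.Tendsto x Filter.atTop (nhds (∫ t, x' t ∂halfLine)) := by
    refine (tendsto_intervalIntegral_halfLine hx').congr' ?_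
    filter_upwards [Filter.eventually_ge_atTop 0] with t ht
    exact (h.2 t ht).symm
  -- By `h1` the function `x` converges, and an integrable function cannot have a nonzero limit
  -- because neighbourhoods of infinity have infinite measure.
  refine IntegrableAtFilter.eq_zero_of_tendsto (μ := volume) (f := x) (l := Filter.atTop)
    ⟨Ici 0, Filter.Ici_mem_atTop 0, hx⟩ (fun s hs => ?_) h1
  obtain ⟨a, ha⟩ := Filter.mem_atTop_sets.1 hs
  exact top_unique (Real.volume_Ici (a := a) ▸ measure_mono fun t ht => ha t ht)

lemma MemLp.integrableOn_Icc {E : Type*} [NormedAddCommGroup E] {f : ℝ → E}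
    (hf : MemLp f 2 halfLine) (T : ℝ) : IntegrableOn f (Icc 0 T) :=
  (hf.mono_measure (restrict_Icc_le_halfLine T)).integrable (by norm_num)

/-- A scalar stable complex differential equation with square integrable forcing has a square
integrable solution. -/
lemma memLp_of_isPrimitive_scalar {a : ℂ} (ha : a.re < 0) {x f : ℝ → ℂ}
    (hf : MemLp f 2 halfLine) (hx : IsPrimitive (fun t => a * x t + f t) x) :
    MemLp x 2 halfLine := by
  have hp := hx.clm_comp Complex.reCLM
  have hq := hx.clm_comp Complex.imCLM
  -- Energy estimate: `hE` differentiates `|x|²`. With `c = -Re a`, completing the square gives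
  -- `(|x|²)' ≤ |f|²/c - c|x|²`, and since `|x(T)|² ≥ 0`, integration bounds `∫₀ᵀ |x|²` by `∫ |f|² /
  -- c²` uniformly in `T`.
  have hE := (hp.mul hp).add (hq.mul hq)
  have hf2 : Integrable (fun t => ‖f t‖ ^ 2) halfLine :=
    (memLp_two_iff_integrable_sq_norm hf.1).1 hf
  have hxc : ∀ T : ℝ, 0 ≤ T → ContinuousOn x (Icc 0 T) := fun T hT => hx.continuousOn_Icc hT
  have hxi : ∀ T : ℝ, IntegrableOn (fun t => ‖x t‖ ^ 2) (Icc 0 T) := fun T => by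
    rcases le_or_gt 0 T with hT | hT
    · exact ((hxc T hT).norm.pow 2).integrableOn_compact isCompact_Icc
    · simp [Icc_eq_empty_of_lt hT]
  set c : ℝ := -a.re with hc
  have hc0 : 0 < c := by linarith
  have hI : Integrable (fun t => ‖x t‖ ^ 2) halfLine := by
    refine integrableOn_halfLine_of_bounded hxi (fun t => by positivity)
      ((∫ t, ‖f t‖ ^ 2 ∂halfLine) / c ^ 2) fun T hT => ?_
    have h1 := hE.2 T hT
    have h2 : (0 : ℝ) ≤ ∫ τ in (0 : ℝ)..T, ((‖f τ‖ ^ 2) / c - c * ‖x τ‖ ^ 2) := by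
      refine le_trans ?_ (intervalIntegral.integral_mono_on hT (hE.intervalIntegrable hT) ?_
        fun t ht => ?_)
      · rw [← h1]; exact add_nonneg (mul_self_nonneg _) (mul_self_nonneg _)
      · refine (intervalIntegrable_iff_integrableOn_Icc_of_le hT).2 (Integrable.sub ?_ ?_)
        · exact (hf2.mono_measure (restrict_Icc_le_halfLine T)).div_const c
        · exact (hxi T).const_mul c
      · have e1 : ‖f t‖ ^ 2 = (f t).re ^ 2 + (f t).im ^ 2 := by
          rw [Complex.sq_norm, Complex.normSq_apply]; ring
        have e2 : ‖x t‖ ^ 2 = (x t).re ^ 2 + (x t).im ^ 2 := by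
          rw [Complex.sq_norm, Complex.normSq_apply]; ring
        have e3 : a.re = -c := by simp [hc]
        have e4 : 0 ≤ ((f t).re - c * (x t).re) ^ 2 / c + ((f t).im - c * (x t).im) ^ 2 / c := by
          positivity
        have e5 : ((f t).re - c * (x t).re) ^ 2 / c + ((f t).im - c * (x t).im) ^ 2 / c =
          ((f t).re ^ 2 + (f t).im ^ 2) / c - 2 * ((f t).re * (x t).re + (f t).im * (x t).im)
            + c * ((x t).re ^ 2 + (x t).im ^ 2) := by
          field_simp
          ring
        simp only [Complex.reCLM_apply, Complex.imCLM_apply, Complex.add_re, Complex.mul_re,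
          Complex.add_im, Complex.mul_im, e1, e2, e3]
        linarith
    have hfi : IntervalIntegrable (fun t => ‖f t‖ ^ 2 / c) volume 0 T :=
      (intervalIntegrable_iff_integrableOn_Icc_of_le hT).2
        ((hf2.mono_measure (restrict_Icc_le_halfLine T)).div_const c)
    have hxi' : IntervalIntegrable (fun t => c * ‖x t‖ ^ 2) volume 0 T :=
      (intervalIntegrable_iff_integrableOn_Icc_of_le hT).2 ((hxi T).const_mul c)
    rw [intervalIntegral.integral_sub hfi hxi', intervalIntegral.integral_div,
      intervalIntegral.integral_const_mul, sub_nonneg] at h2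
    have h3 := intervalIntegral_le_integral_halfLine hf2 (fun t => by positivity) hT
    rw [le_div_iff₀ (by positivity)]
    rw [le_div_iff₀ hc0] at h2
    linarith
  refine (memLp_two_iff_integrable_sq_norm ?_).2 hI
  refine aestronglyMeasurable_halfLine fun T => ?_
  rcases le_or_gt 0 T with hT | hT
  · exact (hxc T hT).aestronglyMeasurable measurableSet_Icc
  · simp [Icc_eq_empty_of_lt hT]

/-! ### Stable linear systems -/

lemma isPrimitive_of_isStateTrajectory {σ ι : Type} [Fintype σ] [Fintype ι] {A : Matrix σ σ ℝ}
    {B : Matrix σ ι ℝ} {u : ℝ → ι → ℝ} {ξ : ℝ → σ → ℝ} (h : IsStateTrajectory A B u ξ)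
    (hu : ∀ T : ℝ, IntegrableOn u (Icc 0 T)) :
    IsPrimitive (fun t => A *ᵥ ξ t + B *ᵥ u t) ξ := by
  refine ⟨fun T => Integrable.add ?_ ?_, h.2⟩
  · refine ContinuousOn.integrableOn_compact isCompact_Icc ?_
    exact (Continuous.matrix_mulVec continuous_const continuous_id).comp_continuousOn
      (h.1.mono Icc_subset_Ici_self)
  · exact (Matrix.mulVecLin B).toContinuousLinearMap.integrable_comp (hu T)

lemma IsPrimitive.continuousOn {E : Type*} [NormedAddCommGroup E] [NormedSpace ℝ E]
    {x' x : ℝ → E} (h : IsPrimitive x' x) : ContinuousOn x (Ici 0) := by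
  intro t ht
  have h1 := h.continuousOn_Icc (T := t + 1) (by linarith [mem_Ici.1 ht]) t ⟨ht, by linarith⟩
  refine h1.mono_of_mem_nhdsWithin ?_
  exact inter_mem_nhdsWithin _ (Iic_mem_nhds (by linarith))

/-- Without forcing, `ξ` coincides on `[0, T]` with a classical solution of `y' = A y`, `y 0 = 0`,
to which uniqueness for Lipschitz equations applies. Applied to differences, this yields causality
and linearity of state-space systems. -/
lemma eq_zero_of_isPrimitive {σ : Type} [Fintype σ] {A : Matrix σ σ ℝ} {ξ f : ℝ → σ → ℝ}
    (h : IsPrimitive (fun t => A *ᵥ ξ t + f t) ξ) {T : ℝ}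
    (hf : ∀ᵐ t ∂volume.restrict (Icc 0 T), f t = 0) : ∀ t ∈ Icc 0 T, ξ t = 0 := by
  rcases lt_or_ge T 0 with hT | hT
  · simp [Icc_eq_empty_of_lt hT]
  let L : (σ → ℝ) →L[ℝ] (σ → ℝ) := (Matrix.mulVecLin A).toContinuousLinearMap
  -- Freezing `ξ` at its initial value for negative times makes it continuous on all of `ℝ`, so that
  -- `y` is differentiable everywhere.
  let x : ℝ → σ → ℝ := fun t => ξ (max 0 t)
  have hx : Continuous x := by
    refine h.continuousOn.comp_continuous (by fun_prop) fun t => ?_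
    exact le_max_left 0 t
  have hLx : Continuous fun t => L (x t) := L.continuous.comp hx
  let y : ℝ → σ → ℝ := fun t => ∫ τ in (0 : ℝ)..t, L (x τ)
  have hy : ∀ t, HasDerivAt y (L (x t)) t := fun t =>
    (hLx.integral_hasStrictDerivAt 0 t).hasDerivAt
  have hxy : ∀ t ∈ Icc 0 T, ξ t = y t := fun t ht => by
    rw [h.2 t ht.1]
    refine intervalIntegral.integral_congr_ae ?_
    filter_upwards [(ae_restrict_iff' measurableSet_Icc).1 hf] with τ hτ hτt
    rw [uIoc_of_le ht.1] at hτt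
    rw [hτ ⟨hτt.1.le, hτt.2.trans ht.2⟩, add_zero]
    simp only [x, max_eq_right hτt.1.le]
    rfl
  have hyc : Continuous y := continuous_iff_continuousAt.2 fun t => (hy t).continuousAt
  have key := ODE_solution_unique (v := fun _ z => L z) (K := ‖L‖₊) (f := y) (g := fun _ => 0)
    (a := 0) (b := T) (fun _ => L.lipschitz) hyc.continuousOn (fun t ht => ?_)
    continuousOn_const (fun t ht => ?_) (by simp [y])
  · intro t ht
    rw [hxy t ht, key ht]
  · have h1 := (hy t).hasDerivWithinAt (s := Ici t)
    have h2 : x t = y t := by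
      rw [← hxy t ⟨ht.1, ht.2.le⟩]
      simp only [x, max_eq_right ht.1]
    rwa [h2] at h1
  · simpa using (hasDerivWithinAt_const t (Ici t) (0 : σ → ℝ))

lemma eq_of_isPrimitive {σ : Type} [Fintype σ] {A : Matrix σ σ ℝ} {ξ₁ ξ₂ f₁ f₂ : ℝ → σ → ℝ}
    (h₁ : IsPrimitive (fun t => A *ᵥ ξ₁ t + f₁ t) ξ₁)
    (h₂ : IsPrimitive (fun t => A *ᵥ ξ₂ t + f₂ t) ξ₂) {T : ℝ}
    (hf : ∀ᵐ t ∂volume.restrict (Icc 0 T), f₁ t = f₂ t) : ∀ t ∈ Icc 0 T, ξ₁ t = ξ₂ t := by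
  have h3 : IsPrimitive (fun t => A *ᵥ (ξ₁ t - ξ₂ t) + (f₁ t - f₂ t)) (fun t => ξ₁ t - ξ₂ t) := by
    refine (h₁.sub h₂).congr (Filter.Eventually.of_forall fun t => ?_)
    simp only [Matrix.mulVec_sub]
    abel
  exact fun t ht => sub_eq_zero.1
    (eq_zero_of_isPrimitive h3 (hf.mono fun t ht => sub_eq_zero.2 ht) t ht)

lemma MemLp.mulVec {σ ι : Type} [Fintype σ] [Fintype ι] {𝕜 : Type*} [RCLike 𝕜]
    (A : Matrix σ ι 𝕜) {f : ℝ → ι → 𝕜} {μ : Measure ℝ} (hf : MemLp f 2 μ) :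
    MemLp (fun t => A *ᵥ f t) 2 μ :=
  (Matrix.mulVecLin A).toContinuousLinearMap.comp_memLp' hf

lemma IsPrimitive.mulVec {σ ι : Type} [Fintype σ] [Fintype ι] {𝕜 : Type*} [RCLike 𝕜]
    (A : Matrix σ ι 𝕜) {x' x : ℝ → ι → 𝕜} (h : IsPrimitive x' x) :
    IsPrimitive (fun t => A *ᵥ x' t) (fun t => A *ᵥ x t) :=
  h.clm_comp ((Matrix.mulVecLin A).toContinuousLinearMap.restrictScalars ℝ)

lemma IsPrimitive.eval {ι : Type} [Fintype ι] {𝕜 : Type*} [RCLike 𝕜] {x' x : ℝ → ι → 𝕜}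
    (h : IsPrimitive x' x) (i : ι) : IsPrimitive (fun t => x' t i) (fun t => x t i) :=
  h.clm_comp (ContinuousLinearMap.proj (R := ℝ) (φ := fun _ : ι => 𝕜) i)

-- Induction on the factors of `p = (X - a) q`, which avoids Jordan forms. The signal `θ = (A - a)
-- x` solves the same kind of equation with forcing `(A - a) f`, and `q(A) θ = p(A) x` is square
-- integrable, so `θ` is too. Then `x' = a x + (θ + f)` decouples into scalar equations.
open Polynomial in
lemma memLp_of_isPrimitive_of_factors {σ : Type} [Fintype σ] [DecidableEq σ] (A : Matrix σ σ ℂ)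
    (s : Multiset ℂ) : (∀ a ∈ s, a.re < 0) → ∀ x f : ℝ → σ → ℂ, MemLp f 2 halfLine →
    IsPrimitive (fun t => A *ᵥ x t + f t) x →
    MemLp (fun t => (aeval A (s.map fun a => X - C a).prod) *ᵥ x t) 2 halfLine →
    MemLp x 2 halfLine := by
  induction s using Multiset.induction_on with
  | empty =>
    intro _ x f _ _ h
    simpa using h
  | cons a s ih =>
    intro hs x f hf hx h
    have hθ : MemLp (fun t => (A - a • 1) *ᵥ x t) 2 halfLine := by
      refine ih (fun b hb => hs b (Multiset.mem_cons_of_mem hb)) _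
        (fun t => (A - a • 1) *ᵥ f t) (MemLp.mulVec _ hf) ?_ ?_
      · refine (hx.mulVec (A - a • 1)).congr (Filter.Eventually.of_forall fun t => ?_)
        simp only [Matrix.mulVec_add, Matrix.mulVec_mulVec]
        congr 2
        simp [sub_mul, mul_sub]
      · simpa only [Multiset.map_cons, Multiset.prod_cons, mul_comm (X - C a), map_mul, map_sub,
          aeval_X, aeval_C, Algebra.algebraMap_eq_smul_one, Matrix.mulVec_mulVec] using h
    refine MemLp.of_eval fun i => ?_
    refine memLp_of_isPrimitive_scalar (hs a (Multiset.mem_cons_self a s)) ((hθ.add hf).eval i) ?_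
    refine (hx.eval i).congr (Filter.Eventually.of_forall fun t => ?_)
    simp [Matrix.sub_mulVec, Matrix.smul_mulVec]
    ring

open Polynomial in
/-- Stable linear systems with square integrable forcing have square integrable states. -/
lemma memLp_of_isHurwitz {σ : Type} [Fintype σ] [DecidableEq σ] {A : Matrix σ σ ℝ}
    (hA : IsHurwitz A) {ξ f : ℝ → σ → ℝ} (hf : MemLp f 2 halfLine)
    (hξ : IsPrimitive (fun t => A *ᵥ ξ t + f t) ξ) : MemLp ξ 2 halfLine := by
  let L : (σ → ℝ) →L[ℝ] (σ → ℂ) := ContinuousLinearMap.pi fun i =>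
    Complex.ofRealCLM.comp (ContinuousLinearMap.proj (R := ℝ) (φ := fun _ : σ => ℝ) i)
  let R : (σ → ℂ) →L[ℝ] (σ → ℝ) := ContinuousLinearMap.pi fun i =>
    Complex.reCLM.comp (ContinuousLinearMap.proj (R := ℝ) (φ := fun _ : σ => ℂ) i)
  let A' : Matrix σ σ ℂ := A.map Complex.ofReal
  have hLA : ∀ v, L (A *ᵥ v) = A' *ᵥ L v := fun v => by
    ext i
    simp [L, A', Matrix.mulVec, dotProduct]
  have hx : IsPrimitive (fun t => A' *ᵥ L (ξ t) + L (f t)) (fun t => L (ξ t)) :=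
    (hξ.clm_comp L).congr (Filter.Eventually.of_forall fun t => by simp only [map_add, hLA])
  have hsplit : A'.charpoly = (A'.charpoly.roots.map fun a => X - C a).prod :=
    (IsAlgClosed.splits A'.charpoly).eq_prod_roots_of_monic A'.charpoly_monic
  -- Taking `p` to be the characteristic polynomial, `p(A) x = 0` by Cayley–Hamilton, and its roots
  -- are eigenvalues, hence in the open left half-plane.
  have h1 : MemLp (fun t => L (ξ t)) 2 halfLine := by
    refine memLp_of_isPrimitive_of_factors A' A'.charpoly.roots (fun a ha => hA a ?_) _ _
      (L.comp_memLp' hf) hx ?_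
    · exact Matrix.mem_spectrum_of_isRoot_charpoly (Polynomial.isRoot_of_mem_roots ha)
    · rw [← hsplit, Matrix.aeval_self_charpoly]
      simp
  have h2 := R.comp_memLp' h1
  have h3 : (R ∘ fun t => L (ξ t)) = ξ := by
    ext t i
    simp [L, R]
  rwa [h3] at h2

/-! ### Fourier transforms of signals on the half line -/

lemma memLp_indicator_ofReal {f : ℝ → ℝ} (hf : MemLp f 2 halfLine) :
    MemLp ((Ici (0 : ℝ)).indicator fun t => (f t : ℂ)) 2 volume :=
  (memLp_indicator_iff_restrict measurableSet_Ici).2 (Complex.ofRealCLM.comp_memLp' hf)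

/-- A square integrable real function on the half line, extended by zero, as an element of `L₂`. -/
noncomputable def extLp (f : ℝ → ℝ) (hf : MemLp f 2 halfLine) : Lp ℂ 2 (volume : Measure ℝ) :=
  (memLp_indicator_ofReal hf).toLp _

/-- The Fourier transform of a square integrable vector valued signal on the half line. -/
noncomputable def hatVec {ι : Type} [Fintype ι] (f : ℝ → ι → ℝ) (hf : MemLp f 2 halfLine)
    (s : ℝ) (i : ι) : ℂ :=
  (𝓕 (extLp (fun t => f t i) (hf.eval i)) : Lp ℂ 2 (volume : Measure ℝ)) s

lemma coeFn_extLp {f : ℝ → ℝ} (hf : MemLp f 2 halfLine) :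
    extLp f hf =ᵐ[volume] (Ici (0 : ℝ)).indicator fun t => (f t : ℂ) :=
  MemLp.coeFn_toLp _

lemma extLp_congr {f g : ℝ → ℝ} (hf : MemLp f 2 halfLine) (hg : MemLp g 2 halfLine)
    (h : f =ᵐ[halfLine] g) : extLp f hf = extLp g hg := by
  refine (MemLp.toLp_eq_toLp_iff _ _).2 ?_
  filter_upwards [(ae_restrict_iff' measurableSet_Ici).1 h] with t ht
  by_cases h0 : t ∈ Ici (0 : ℝ)
  · simp only [indicator_of_mem h0, ht h0]
  · simp only [indicator_of_notMem h0]

lemma extLp_add {f g : ℝ → ℝ} (hf : MemLp f 2 halfLine) (hg : MemLp g 2 halfLine) :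
    extLp (fun t => f t + g t) (hf.add hg) = extLp f hf + extLp g hg := by
  refine Eq.trans ?_ (MemLp.toLp_add _ _)
  refine (MemLp.toLp_eq_toLp_iff _ _).2 (Filter.Eventually.of_forall fun t => ?_)
  by_cases h0 : t ∈ Ici (0 : ℝ) <;> simp [h0]

lemma extLp_const_mul {f : ℝ → ℝ} (hf : MemLp f 2 halfLine) (c : ℝ) :
    extLp (fun t => c * f t) (hf.const_mul c) = (c : ℂ) • extLp f hf := by
  refine Eq.trans ?_ (MemLp.toLp_const_smul _ _)
  refine (MemLp.toLp_eq_toLp_iff _ _).2 (Filter.Eventually.of_forall fun t => ?_)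
  by_cases h0 : t ∈ Ici (0 : ℝ) <;> simp [h0]

lemma extLp_sum {ι : Type} (s : Finset ι) (f : ι → ℝ → ℝ) (hf : ∀ i, MemLp (f i) 2 halfLine)
    (h : MemLp (fun t => ∑ i ∈ s, f i t) 2 halfLine) :
    extLp (fun t => ∑ i ∈ s, f i t) h = ∑ i ∈ s, extLp (f i) (hf i) := by
  classical
  induction s using Finset.induction_on with
  | empty =>
    refine Eq.trans ?_ (MemLp.toLp_zero (MemLp.zero' (p := 2) (μ := (volume : Measure ℝ))
      (ε := ℂ)))
    refine (MemLp.toLp_eq_toLp_iff _ _).2 (Filter.Eventually.of_forall fun t => ?_)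
    simp
  | insert i s hi ih =>
    have hs : MemLp (fun t => ∑ i ∈ s, f i t) 2 halfLine := memLp_finsetSum s fun i _ => hf i
    rw [Finset.sum_insert hi, ← ih hs, ← extLp_add]
    exact extLp_congr _ _ (Filter.Eventually.of_forall fun t => Finset.sum_insert hi)

section hatVec

variable {ι κ : Type} [Fintype ι] [Fintype κ]

lemma hatVec_congr {f g : ℝ → ι → ℝ} (hf : MemLp f 2 halfLine) (hg : MemLp g 2 halfLine)
    (h : f =ᵐ[halfLine] g) : hatVec f hf = hatVec g hg := by
  ext s i
  rw [hatVec, hatVec, extLp_congr (hf.eval i) (hg.eval i) (h.mono fun t ht => congrFun ht i)]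

lemma hatVec_add {f g : ℝ → ι → ℝ} (hf : MemLp f 2 halfLine) (hg : MemLp g 2 halfLine) :
    ∀ᵐ s, hatVec (fun t => f t + g t) (hf.add hg) s = hatVec f hf s + hatVec g hg s := by
  have h : ∀ i, ∀ᵐ s, hatVec (fun t => f t + g t) (hf.add hg) s i =
      hatVec f hf s i + hatVec g hg s i := fun i => by
    have h1 : 𝓕 (extLp (fun t => f t i + g t i) ((hf.eval i).add (hg.eval i))) =
      𝓕 (extLp (fun t => f t i) (hf.eval i)) + 𝓕 (extLp (fun t => g t i) (hg.eval i)) := by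
      rw [extLp_add, FourierTransform.fourier_add]
    filter_upwards [Lp.coeFn_add (𝓕 (extLp (fun t => f t i) (hf.eval i)))
      (𝓕 (extLp (fun t => g t i) (hg.eval i)))] with s hs
    rw [← h1] at hs
    exact hs
  filter_upwards [ae_all_iff.2 h] with s hs
  ext i
  exact hs i

lemma hatVec_mulVec (A : Matrix κ ι ℝ) {f : ℝ → ι → ℝ} (hf : MemLp f 2 halfLine) :
    ∀ᵐ s, hatVec (fun t => A *ᵥ f t) (MemLp.mulVec A hf) s =
      A.map Complex.ofReal *ᵥ hatVec f hf s := by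
  have h : ∀ k, ∀ᵐ s, hatVec (fun t => A *ᵥ f t) (MemLp.mulVec A hf) s k =
      (A.map Complex.ofReal *ᵥ hatVec f hf s) k := fun k => by
    have h1 : 𝓕 (extLp (fun t => (A *ᵥ f t) k) ((MemLp.mulVec A hf).eval k)) =
        ∑ i, (A k i : ℂ) • 𝓕 (extLp (fun t => f t i) (hf.eval i)) := by
      have h2 := extLp_sum Finset.univ (fun i t => A k i * f t i)
        (fun i => (hf.eval i).const_mul (A k i)) ((MemLp.mulVec A hf).eval k)
      refine (congrArg 𝓕 h2).trans ?_
      rw [FourierTransform.fourier_sum]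
      refine Finset.sum_congr rfl fun i _ => ?_
      rw [extLp_const_mul (hf.eval i), FourierTransform.fourier_smul]
    have h3 : ∀ᵐ s, ∀ i, ((A k i : ℂ) • 𝓕 (extLp (fun t => f t i) (hf.eval i)) :
        Lp ℂ 2 (volume : Measure ℝ)) s = A k i * hatVec f hf s i := by
      rw [ae_all_iff]
      intro i
      filter_upwards [Lp.coeFn_smul (A k i : ℂ) (𝓕 (extLp (fun t => f t i) (hf.eval i)))] with s hs
      rw [hs]
      rfl
    filter_upwards [Lp.coeFn_finsetSum Finset.univ
      fun i => (A k i : ℂ) • 𝓕 (extLp (fun t => f t i) (hf.eval i)), h3] with s hs h3s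
    rw [← h1] at hs
    refine hs.trans ?_
    simp only [Finset.sum_apply, h3s]
    rfl
  filter_upwards [ae_all_iff.2 h] with s hs
  ext i
  exact hs i

/-- Parseval's identity. -/
lemma integral_mul_halfLine {f g : ℝ → ℝ} (hf : MemLp f 2 halfLine) (hg : MemLp g 2 halfLine) :
    ((∫ t, f t * g t ∂halfLine : ℝ) : ℂ) =
      ∫ s, star ((𝓕 (extLp f hf) : Lp ℂ 2 (volume : Measure ℝ)) s) *
        (𝓕 (extLp g hg) : Lp ℂ 2 (volume : Measure ℝ)) s := by
  have h1 := Lp.inner_fourier_eq (extLp f hf) (extLp g hg)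
  rw [L2.inner_def, L2.inner_def] at h1
  simp only [RCLike.inner_apply'] at h1
  refine Eq.trans ?_ h1.symm
  rw [← integral_complex_ofReal, halfLine, ← integral_indicator measurableSet_Ici]
  refine integral_congr_ae ?_
  filter_upwards [coeFn_extLp hf, coeFn_extLp hg] with t h2 h3
  rw [h2, h3]
  by_cases h0 : t ∈ Ici (0 : ℝ)
  · simp only [indicator_of_mem h0, Complex.ofReal_mul]
    simp
  · simp only [indicator_of_notMem h0, mul_zero]

end hatVec

/-! ### Differentiation and the Fourier transform -/

lemma integrable_mul_halfLine {f g : ℝ → ℝ} (hf : MemLp f 2 halfLine) (hg : MemLp g 2 halfLine) :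
    Integrable (fun t => f t * g t) halfLine :=
  hf.integrable_mul hg

/-- Integration by parts on the half line. -/
lemma IsPrimitive.integral_mul_deriv {x' x : ℝ → ℝ} (h : IsPrimitive x' x)
    (hx' : MemLp x' 2 halfLine) (hx : MemLp x 2 halfLine) {φ φ' : ℝ → ℝ}
    (hφ : ∀ t, HasDerivAt φ (φ' t) t) (hφ' : Continuous φ') (h2 : MemLp φ 2 halfLine)
    (h2' : MemLp φ' 2 halfLine) :
    ∫ t, φ t * x' t ∂halfLine = -∫ t, φ' t * x t ∂halfLine := by
  -- Primitives vanish at `0`, so `φ` is shifted by `φ 0` and the shift is restored in `h3`. The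
  -- boundary term at `0` disappears because `x 0 = 0`, the one at infinity by integrability of `φ
  -- x` and of its derivative.
  have h1 : IsPrimitive φ' (fun t => φ t - φ 0) :=
    ⟨fun T => hφ'.continuousOn.integrableOn_compact isCompact_Icc, fun t _ =>
      (intervalIntegral.integral_eq_sub_of_hasDerivAt (fun s _ => hφ s)
        (hφ'.intervalIntegrable 0 t)).symm⟩
  have h3 := (h1.mul h).add (h.const_mul (φ 0))
  have h4 : IsPrimitive (fun t => φ' t * x t + φ t * x' t) (fun t => φ t * x t) := by
    convert h3 using 2 <;> ring
  have h5 := h4.integral_eq_zero ((integrable_mul_halfLine h2' hx).add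
    (integrable_mul_halfLine h2 hx')) (integrable_mul_halfLine h2 hx)
  rw [integral_add (integrable_mul_halfLine h2' hx) (integrable_mul_halfLine h2 hx')] at h5
  linarith

open scoped SchwartzMap LineDeriv

/-- Integration by parts against complex Schwartz functions. -/
lemma IsPrimitive.integral_schwartz_mul {x' x : ℝ → ℝ} (h : IsPrimitive x' x)
    (hx' : MemLp x' 2 halfLine) (hx : MemLp x 2 halfLine) (g : 𝓢(ℝ, ℂ)) :
    ∫ t, g t * (x' t : ℂ) ∂halfLine = -∫ t, deriv g t * (x t : ℂ) ∂halfLine := by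
  have hg : ∀ t, HasDerivAt g (deriv g t) t := fun t => g.differentiableAt.hasDerivAt
  have hgc : Continuous (deriv g) := (SchwartzMap.derivCLM ℂ ℂ g).continuous
  have hg2 : MemLp g 2 halfLine := (g.memLp 2 volume).restrict _
  have hg2' : MemLp (deriv g) 2 halfLine := 
    ((SchwartzMap.derivCLM ℂ ℂ g).memLp 2 volume).restrict _
  have hre := h.integral_mul_deriv hx' hx
    (fun t => Complex.reCLM.hasFDerivAt.comp_hasDerivAt t (hg t))
    (Complex.continuous_re.comp hgc) (Complex.reCLM.comp_memLp' hg2)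
    (Complex.reCLM.comp_memLp' hg2')
  have him := h.integral_mul_deriv hx' hx
    (fun t => Complex.imCLM.hasFDerivAt.comp_hasDerivAt t (hg t))
    (Complex.continuous_im.comp hgc) (Complex.imCLM.comp_memLp' hg2)
    (Complex.imCLM.comp_memLp' hg2')
  have hx'c : MemLp (fun t => (x' t : ℂ)) 2 halfLine := Complex.ofRealCLM.comp_memLp' hx'
  have hxc : MemLp (fun t => (x t : ℂ)) 2 halfLine := Complex.ofRealCLM.comp_memLp' hx
  have i1 : Integrable (fun t => g t * (x' t : ℂ)) halfLine := hg2.integrable_mul hx'c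
  have i2 : Integrable (fun t => deriv g t * (x t : ℂ)) halfLine := hg2'.integrable_mul hxc
  have r1 := Complex.reCLM.integral_comp_comm i1
  have r2 := Complex.reCLM.integral_comp_comm i2
  have r3 := Complex.imCLM.integral_comp_comm i1
  have r4 := Complex.imCLM.integral_comp_comm i2
  simp only [Complex.reCLM_apply, Complex.imCLM_apply, Complex.mul_re, Complex.mul_im,
    Complex.ofReal_re, Complex.ofReal_im, mul_zero, sub_zero, zero_add] at r1 r2 r3 r4
  refine Complex.ext ?_ ?_
  · rw [Complex.neg_re, ← r1, ← r2]
    exact hre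
  · rw [Complex.neg_im, ← r3, ← r4]
    exact him

lemma integral_mul_extLp {f : ℝ → ℝ} (hf : MemLp f 2 halfLine) (g : ℝ → ℂ) :
    ∫ t, g t • extLp f hf t = ∫ t, g t * (f t : ℂ) ∂halfLine := by
  rw [halfLine, ← integral_indicator measurableSet_Ici]
  refine integral_congr_ae ?_
  filter_upwards [coeFn_extLp hf] with t ht
  rw [ht, smul_eq_mul]
  by_cases h0 : t ∈ Ici (0 : ℝ)
  · simp only [indicator_of_mem h0]
  · simp only [indicator_of_notMem h0, mul_zero]

/-- The Fourier transform of a derivative. -/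
lemma IsPrimitive.fourier_extLp {x' x : ℝ → ℝ} (h : IsPrimitive x' x)
    (hx' : MemLp x' 2 halfLine) (hx : MemLp x 2 halfLine) :
    ∀ᵐ s : ℝ, (𝓕 (extLp x' hx') : Lp ℂ 2 (volume : Measure ℝ)) s =
      2 * Real.pi * Complex.I * s * (𝓕 (extLp x hx) : Lp ℂ 2 (volume : Measure ℝ)) s := by
  -- Extension by zero commutes with the distributional derivative: since `x 0 = 0` there is no
  -- jump, hence no Dirac mass, at the origin.
  have h1 : (extLp x' hx' : 𝓢'(ℝ, ℂ)) = ∂_{(1 : ℝ)} (extLp x hx : 𝓢'(ℝ, ℂ)) := by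
    ext g
    rw [TemperedDistribution.lineDerivOp_apply_apply, map_neg, Lp.toTemperedDistribution_apply,
      Lp.toTemperedDistribution_apply, integral_mul_extLp, integral_mul_extLp,
      h.integral_schwartz_mul hx' hx]
    rfl
  have h2 := congrArg 𝓕 h1
  rw [TemperedDistribution.fourier_lineDerivOp_eq, Lp.fourier_toTemperedDistribution_eq,
    Lp.fourier_toTemperedDistribution_eq] at h2
  set X' : Lp ℂ 2 (volume : Measure ℝ) := 𝓕 (extLp x' hx')
  set X : Lp ℂ 2 (volume : Measure ℝ) := 𝓕 (extLp x hx)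
  have hX' : LocallyIntegrable X' := (Lp.memLp X').locallyIntegrable (by norm_num)
  have hX : LocallyIntegrable X := (Lp.memLp X).locallyIntegrable (by norm_num)
  have hXs : LocallyIntegrable fun s : ℝ => 2 * Real.pi * Complex.I * s * X s := by
    have hc : Continuous fun s : ℝ => 2 * Real.pi * Complex.I * s := by fun_prop
    exact hX.continuous_mul hc
  -- The equality of tempered distributions is tested on smooth compactly supported functions, which
  -- separate locally integrable functions up to null sets.
  refine ae_eq_of_integral_contDiff_smul_eq hX' hXs fun g hg hgc => ?_
  have hg₁ : HasCompactSupport (Complex.ofRealCLM ∘ g) := hgc.comp_left rfl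
  have hg₂ : ContDiff ℝ (⊤ : ℕ∞) (Complex.ofRealCLM ∘ g) := by fun_prop
  have hcoe : ∀ s, hg₁.toSchwartzMap hg₂ s = (g s : ℂ) := fun _ => rfl
  have h3 := DFunLike.congr_fun h2 (hg₁.toSchwartzMap hg₂)
  have h4 : (fun s : ℝ => (s : ℂ)).HasTemperateGrowth := by fun_prop
  simp only [Lp.toTemperedDistribution_apply, hcoe, smul_eq_mul, RCLike.inner_apply,
    smul_apply, TemperedDistribution.smulLeftCLM_apply_apply,
    SchwartzMap.smulLeftCLM_apply_apply h4, conj_trivial, one_mul] at h3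
  simp only [Complex.real_smul]
  rw [h3, ← integral_const_mul]
  refine integral_congr_ae (Filter.Eventually.of_forall fun s => ?_)
  dsimp only
  ring

/-! ### Stable systems and quadratic costs in the frequency domain -/

section

variable {σ ι κ : Type} [Fintype σ] [Fintype ι] [Fintype κ]

lemma IsPrimitive.hatVec {x' x : ℝ → σ → ℝ} (h : IsPrimitive x' x) (hx' : MemLp x' 2 halfLine)
    (hx : MemLp x 2 halfLine) :
    ∀ᵐ s : ℝ, hatVec x' hx' s = (Complex.I * (2 * Real.pi * s : ℝ)) • hatVec x hx s := by
  filter_upwards [ae_all_iff.2 fun i => (h.eval i).fourier_extLp (hx'.eval i) (hx.eval i)] with s hs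
  ext i
  refine (hs i).trans ?_
  simp only [_root_.hatVec, Pi.smul_apply, smul_eq_mul]
  push_cast
  ring

lemma isUnit_resolvent [DecidableEq σ] {A : Matrix σ σ ℝ} (hA : IsHurwitz A) {s : ℂ}
    (hs : 0 ≤ s.re) : IsUnit (s • (1 : Matrix σ σ ℂ) - A.map Complex.ofReal) := by
  by_contra h
  refine (hA s ?_).not_ge hs
  rwa [spectrum.mem_iff, Algebra.algebraMap_eq_smul_one]

/-- The output of a stable system in the frequency domain. -/
lemma hatVec_output [DecidableEq σ] {A : Matrix σ σ ℝ} {B : Matrix σ ι ℝ} (hA : IsHurwitz A)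
    {ξ : ℝ → σ → ℝ} {u : ℝ → ι → ℝ} (h : IsPrimitive (fun t => A *ᵥ ξ t + B *ᵥ u t) ξ)
    (hξ : MemLp ξ 2 halfLine) (hu : MemLp u 2 halfLine) (C : Matrix κ σ ℝ) (D : Matrix κ ι ℝ)
    {y : ℝ → κ → ℝ} (hy : MemLp y 2 halfLine)
    (hyu : ∀ᵐ t ∂halfLine, y t = C *ᵥ ξ t + D *ᵥ u t) :
    ∀ᵐ s : ℝ, hatVec y hy s =
      transferMatrix A B C D (Complex.I * (2 * Real.pi * s : ℝ)) *ᵥ hatVec u hu s := by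
  have hAB := (MemLp.mulVec A hξ).add (MemLp.mulVec B hu)
  have hCD := (MemLp.mulVec C hξ).add (MemLp.mulVec D hu)
  rw [hatVec_congr hy hCD hyu]
  filter_upwards [h.hatVec hAB hξ, hatVec_add (MemLp.mulVec A hξ) (MemLp.mulVec B hu),
    hatVec_add (MemLp.mulVec C hξ) (MemLp.mulVec D hu), hatVec_mulVec A hξ, hatVec_mulVec B hu,
    hatVec_mulVec C hξ, hatVec_mulVec D hu] with s h1 h2 h3 hsA hsB hsC hsD
  have e1 := h1.symm.trans h2
  rw [hsA, hsB] at e1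
  have e2 : hatVec (fun t => C *ᵥ ξ t + D *ᵥ u t) hCD s = _ := h3
  rw [hsC, hsD] at e2
  refine e2.trans ?_
  generalize hz : (Complex.I * (2 * Real.pi * s : ℝ)) = z at *
  have hz0 : 0 ≤ z.re := by rw [← hz]; simp
  have hR := (Matrix.isUnit_iff_isUnit_det _).1 (isUnit_resolvent hA hz0)
  -- The transformed state equation is `(z I - A) ξ̂ = B û` with `z` on the imaginary axis, where
  -- the resolvent of a Hurwitz matrix exists.
  have e3 : hatVec ξ hξ s = (z • (1 : Matrix σ σ ℂ) - A.map Complex.ofReal)⁻¹ *ᵥ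
      (B.map Complex.ofReal *ᵥ hatVec u hu s) := by
    have e4 : (z • (1 : Matrix σ σ ℂ) - A.map Complex.ofReal) *ᵥ hatVec ξ hξ s =
        B.map Complex.ofReal *ᵥ hatVec u hu s := by
      rw [Matrix.sub_mulVec, Matrix.smul_mulVec, Matrix.one_mulVec, e1, add_sub_cancel_left]
    rw [← e4, Matrix.mulVec_mulVec, Matrix.nonsing_inv_mul _ hR, Matrix.one_mulVec]
  rw [e3, transferMatrix, Matrix.add_mulVec, Matrix.mulVec_mulVec, Matrix.mulVec_mulVec,
    Matrix.mul_assoc]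

/-- Parseval's identity for quadratic forms. -/
lemma integral_quadratic_halfLine (M : Matrix κ κ ℝ) {y : ℝ → κ → ℝ} (hy : MemLp y 2 halfLine) :
    ∫ t, y t ⬝ᵥ (M *ᵥ y t) ∂halfLine =
      ∫ s, (star (hatVec y hy s) ⬝ᵥ (M.map Complex.ofReal *ᵥ hatVec y hy s)).re := by
  have hF : ∀ i, MemLp (fun s => hatVec y hy s i) 2 volume := fun i => Lp.memLp _
  have hint : ∀ i j, Integrable (fun s => star (hatVec y hy s i) * hatVec y hy s j) volume :=
    fun i j => (hF i).star.integrable_mul (hF j)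
  have h1 : ∀ t, y t ⬝ᵥ (M *ᵥ y t) = ∑ i, ∑ j, M i j * (y t i * y t j) := fun t => by
    simp only [dotProduct, Matrix.mulVec, Finset.mul_sum]
    exact Finset.sum_congr rfl fun i _ => Finset.sum_congr rfl fun j _ => by ring
  have h2 : ∀ s, star (hatVec y hy s) ⬝ᵥ (M.map Complex.ofReal *ᵥ hatVec y hy s) =
      ∑ i, ∑ j, (M i j : ℂ) * (star (hatVec y hy s i) * hatVec y hy s j) := fun s => by
    simp only [dotProduct, Matrix.mulVec, Finset.mul_sum, Pi.star_apply, Matrix.map_apply]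
    exact Finset.sum_congr rfl fun i _ => Finset.sum_congr rfl fun j _ => by ring
  have hint2 : Integrable (fun s => ∑ i, ∑ j, (M i j : ℂ) *
      (star (hatVec y hy s i) * hatVec y hy s j)) volume :=
    integrable_finsetSum _ fun i _ => integrable_finsetSum _ fun j _ => (hint i j).const_mul _
  have hint3 : ∀ i j, Integrable (fun t => M i j * (y t i * y t j)) halfLine := fun i j =>
    ((hy.eval i).integrable_mul (hy.eval j)).const_mul _
  simp only [h1, h2]
  have h3 := Complex.reCLM.integral_comp_comm hint2
  simp only [Complex.reCLM_apply] at h3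
  -- Both sides become real parts of complex numbers, so it suffices to prove the complex identity,
  -- which follows entrywise from Parseval.
  rw [h3, ← Complex.ofReal_re (∫ t, _ ∂halfLine)]
  congr 1
  rw [integral_finsetSum _ fun i _ => integrable_finsetSum _ fun j _ => hint3 i j,
    integral_finsetSum _ fun i _ => integrable_finsetSum _ fun j _ => (hint i j).const_mul _,
    Complex.ofReal_sum]
  refine Finset.sum_congr rfl fun i _ => ?_
  rw [integral_finsetSum _ fun j _ => hint3 i j,
    integral_finsetSum _ fun j _ => (hint i j).const_mul _, Complex.ofReal_sum]
  refine Finset.sum_congr rfl fun j _ => ?_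
  rw [integral_const_mul, integral_const_mul, Complex.ofReal_mul,
    integral_mul_halfLine (hy.eval i) (hy.eval j)]
  rfl

/-- The quadratic cost of a stable filter in the frequency domain. -/
lemma integral_quadratic_output [DecidableEq σ] {A : Matrix σ σ ℝ} {B : Matrix σ ι ℝ}
    (hA : IsHurwitz A) {ξ : ℝ → σ → ℝ} {u : ℝ → ι → ℝ}
    (h : IsPrimitive (fun t => A *ᵥ ξ t + B *ᵥ u t) ξ)
    (hξ : MemLp ξ 2 halfLine) (hu : MemLp u 2 halfLine) (C : Matrix κ σ ℝ) (D : Matrix κ ι ℝ)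
    (M : Matrix κ κ ℝ) :
    ∫ t, (C *ᵥ ξ t + D *ᵥ u t) ⬝ᵥ (M *ᵥ (C *ᵥ ξ t + D *ᵥ u t)) ∂halfLine =
      ∫ s, (star (hatVec u hu s) ⬝ᵥ
        (multiplier A B C D M (2 * Real.pi * s) *ᵥ hatVec u hu s)).re := by
  have hCD : MemLp (fun t => C *ᵥ ξ t + D *ᵥ u t) 2 halfLine :=
    (MemLp.mulVec C hξ).add (MemLp.mulVec D hu)
  rw [integral_quadratic_halfLine M hCD]
  refine integral_congr_ae ?_
  filter_upwards [hatVec_output hA h hξ hu C D hCD (Filter.Eventually.of_forall fun _ => rfl)]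
    with s hs
  rw [hs, multiplier, Matrix.star_mulVec, ← Matrix.dotProduct_mulVec, Matrix.mulVec_mulVec,
    Matrix.mulVec_mulVec, Matrix.mul_assoc]

end

/-! ### Dissipation -/

section

variable {σ ι κ : Type} [Fintype σ] [Fintype ι] [Fintype κ]

lemma IsPrimitive.quadratic (Z : Matrix σ σ ℝ) {x' x : ℝ → σ → ℝ} (h : IsPrimitive x' x) :
    IsPrimitive (fun t => x' t ⬝ᵥ (Z *ᵥ x t) + x t ⬝ᵥ (Z *ᵥ x' t))
      (fun t => x t ⬝ᵥ (Z *ᵥ x t)) := by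
  have h1 := IsPrimitive.sum Finset.univ fun i (_ : i ∈ Finset.univ) =>
    (h.eval i).mul ((h.mulVec Z).eval i)
  have h2 : (fun t => ∑ i, (x' t i * (Z *ᵥ x t) i + x t i * (Z *ᵥ x' t) i)) =
      fun t => x' t ⬝ᵥ (Z *ᵥ x t) + x t ⬝ᵥ (Z *ᵥ x' t) := by
    funext t
    rw [Finset.sum_add_distrib]
    rfl
  rwa [h2] at h1

lemma integrable_dotProduct {μ : Measure ℝ} {x y : ℝ → ι → ℝ} (hx : MemLp x 2 μ)
    (hy : MemLp y 2 μ) : Integrable (fun t => x t ⬝ᵥ y t) μ :=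
  integrable_finsetSum _ fun i _ => (hx.eval i).integrable_mul (hy.eval i)

/-- This is the quadratic form of the certificate evaluated at `col(x, u)`. The terms with `Z` are
the derivative of the storage `xᵀ Z x` along `x' = A x + B u`. -/
lemma dissipation_eq {A : Matrix σ σ ℝ} {B : Matrix σ ι ℝ} {C : Matrix κ σ ℝ}
    {D : Matrix κ ι ℝ} {M : Matrix κ κ ℝ} {Z : Matrix σ σ ℝ} {M' : Matrix ι ι ℝ}
    {C' : Matrix ι σ ℝ} {D' : Matrix ι ι ℝ}
    (h : Matrix.fromBlocks (Aᵀ * Z + Z * A + Cᵀ * M * C) (Z * B + Cᵀ * M * D)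
      (Bᵀ * Z + Dᵀ * M * C) (Dᵀ * M * D) =
      (Matrix.fromCols C' D')ᵀ * M' * Matrix.fromCols C' D') (x : σ → ℝ) (u : ι → ℝ) :
    (C' *ᵥ x + D' *ᵥ u) ⬝ᵥ (M' *ᵥ (C' *ᵥ x + D' *ᵥ u)) =
      (C *ᵥ x + D *ᵥ u) ⬝ᵥ (M *ᵥ (C *ᵥ x + D *ᵥ u)) +
        ((A *ᵥ x + B *ᵥ u) ⬝ᵥ (Z *ᵥ x) + x ⬝ᵥ (Z *ᵥ (A *ᵥ x + B *ᵥ u))) := by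
  have h1 := congrArg (fun N => Sum.elim x u ⬝ᵥ (N *ᵥ Sum.elim x u)) h
  have tr : ∀ {α β : Type} [Fintype α] [Fintype β] (N : Matrix α β ℝ) (a : β → ℝ) (b : α → ℝ),
      a ⬝ᵥ (Nᵀ *ᵥ b) = (N *ᵥ a) ⬝ᵥ b := fun N a b => by
    rw [Matrix.dotProduct_mulVec, Matrix.vecMul_transpose]
  simp only [← Matrix.mulVec_mulVec, Matrix.fromCols_mulVec_sumElim, tr] at h1
  rw [← h1]
  simp only [Matrix.fromBlocks_mulVec, Sum.elim_comp_inl, Sum.elim_comp_inr,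
    sumElim_dotProduct_sumElim, Matrix.add_mulVec,
    ← Matrix.mulVec_mulVec, dotProduct_add, add_dotProduct, Matrix.mulVec_add, tr]
  ring

end

section

variable {σ ι κ : Type} [Fintype σ] [Fintype ι] [Fintype κ] {A : Matrix σ σ ℝ}
  {B : Matrix σ ι ℝ} {C : Matrix κ σ ℝ} {D : Matrix κ ι ℝ} {M : Matrix κ κ ℝ} {Z : Matrix σ σ ℝ}
  {M' : Matrix ι ι ℝ} {C' : Matrix ι σ ℝ} {D' : Matrix ι ι ℝ} {ξ : ℝ → σ → ℝ} {u : ℝ → ι → ℝ}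

lemma integrable_quadratic_output {μ : Measure ℝ} (C : Matrix κ σ ℝ) (D : Matrix κ ι ℝ)
    (M : Matrix κ κ ℝ) (hξ : MemLp ξ 2 μ) (hu : MemLp u 2 μ) :
    Integrable (fun t => (C *ᵥ ξ t + D *ᵥ u t) ⬝ᵥ (M *ᵥ (C *ᵥ ξ t + D *ᵥ u t))) μ := by
  have h : MemLp (fun t => C *ᵥ ξ t + D *ᵥ u t) 2 μ := (MemLp.mulVec C hξ).add (MemLp.mulVec D hu)
  exact integrable_dotProduct h (MemLp.mulVec M h)

/-- The finite horizon costs of two filters related by a certificate. -/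
lemma intervalIntegral_dissipation
    (h : Matrix.fromBlocks (Aᵀ * Z + Z * A + Cᵀ * M * C) (Z * B + Cᵀ * M * D)
      (Bᵀ * Z + Dᵀ * M * C) (Dᵀ * M * D) =
      (Matrix.fromCols C' D')ᵀ * M' * Matrix.fromCols C' D')
    (hξ : IsPrimitive (fun t => A *ᵥ ξ t + B *ᵥ u t) ξ) {T : ℝ} (hT : 0 ≤ T)
    (hu : MemLp u 2 (volume.restrict (Icc 0 T))) :
    (∫ t in (0 : ℝ)..T, (C *ᵥ ξ t + D *ᵥ u t) ⬝ᵥ (M *ᵥ (C *ᵥ ξ t + D *ᵥ u t))) +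
        ξ T ⬝ᵥ (Z *ᵥ ξ T) =
      ∫ t in (0 : ℝ)..T, (C' *ᵥ ξ t + D' *ᵥ u t) ⬝ᵥ (M' *ᵥ (C' *ᵥ ξ t + D' *ᵥ u t)) := by
  have hξ2 := hξ.memLp_Icc hT
  have hq := hξ.quadratic Z
  simp only [dissipation_eq h]
  rw [intervalIntegral.integral_add _ (hq.intervalIntegrable hT), ← hq.2 T hT]
  exact (intervalIntegrable_iff_integrableOn_Icc_of_le hT).2
    (integrable_quadratic_output C D M hξ2 hu)

/-- The infinite horizon costs of two filters related by a certificate. -/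
lemma integral_dissipation
    (h : Matrix.fromBlocks (Aᵀ * Z + Z * A + Cᵀ * M * C) (Z * B + Cᵀ * M * D)
      (Bᵀ * Z + Dᵀ * M * C) (Dᵀ * M * D) =
      (Matrix.fromCols C' D')ᵀ * M' * Matrix.fromCols C' D')
    (hξ : IsPrimitive (fun t => A *ᵥ ξ t + B *ᵥ u t) ξ)
    (hξ2 : MemLp ξ 2 halfLine) (hu : MemLp u 2 halfLine) :
    ∫ t, (C *ᵥ ξ t + D *ᵥ u t) ⬝ᵥ (M *ᵥ (C *ᵥ ξ t + D *ᵥ u t)) ∂halfLine =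
      ∫ t, (C' *ᵥ ξ t + D' *ᵥ u t) ⬝ᵥ (M' *ᵥ (C' *ᵥ ξ t + D' *ᵥ u t)) ∂halfLine := by
  have hξ' : MemLp (fun t => A *ᵥ ξ t + B *ᵥ u t) 2 halfLine :=
    (MemLp.mulVec A hξ2).add (MemLp.mulVec B hu)
  have hq := hξ.quadratic Z
  -- The storage `ξᵀ Z ξ` and its derivative are both integrable, so the storage tends to zero and
  -- its derivative has integral zero.
  have hqi : Integrable (fun t => (A *ᵥ ξ t + B *ᵥ u t) ⬝ᵥ (Z *ᵥ ξ t) +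
      ξ t ⬝ᵥ (Z *ᵥ (A *ᵥ ξ t + B *ᵥ u t))) halfLine :=
    (integrable_dotProduct hξ' (MemLp.mulVec Z hξ2)).add
      (integrable_dotProduct hξ2 (MemLp.mulVec Z hξ'))
  simp only [dissipation_eq h]
  rw [integral_add (integrable_quadratic_output C D M hξ2 hu) hqi,
    hq.integral_eq_zero hqi (integrable_dotProduct hξ2 (MemLp.mulVec Z hξ2)), add_zero]

end

/-! ### Signals as vector valued functions -/

/-- The values of a signal as vectors. -/
noncomputable def L2e.vec {n : ℕ} (x : L2e n) (t : ℝ) : Fin n → ℝ := (x.val t).ofLp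

namespace L2e

variable {n m p : ℕ}

lemma memLp_vec_Icc (x : L2e n) (T : ℝ) : MemLp x.vec 2 (volume.restrict (Icc 0 T)) :=
  (EuclideanSpace.equiv (Fin n) ℝ).toContinuousLinearMap.comp_memLp' (x.2 T)

lemma inL2_iff {x : L2e n} : x.InL2 ↔ MemLp x.vec 2 halfLine := by
  refine ⟨fun h => ?_, fun h => ?_⟩
  · have h1 : MemLp x.val 2 halfLine := ⟨x.1.aestronglyMeasurable, h⟩
    exact (EuclideanSpace.equiv (Fin n) ℝ).toContinuousLinearMap.comp_memLp' h1
  · have h1 := (EuclideanSpace.equiv (Fin n) ℝ).symm.toContinuousLinearMap.comp_memLp' h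
    exact h1.2

lemma ext_vec {x y : L2e n} (h : x.vec =ᵐ[halfLine] y.vec) : x = y := by
  refine Subtype.ext (AEEqFun.ext ?_)
  filter_upwards [h] with t ht
  exact WithLp.ofLp_injective 2 ht

lemma vec_sub (x y : L2e n) : (x - y).vec =ᵐ[halfLine] fun t => x.vec t - y.vec t := by
  filter_upwards [AEEqFun.coeFn_sub x.1 y.1] with t ht
  exact congrArg WithLp.ofLp ht

lemma exists_vec_eq {f : ℝ → Fin n → ℝ} (hf : MemLp f 2 halfLine) :
    ∃ x : L2e n, x.vec =ᵐ[halfLine] f := by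
  have h := (EuclideanSpace.equiv (Fin n) ℝ).symm.toContinuousLinearMap.comp_memLp' hf
  refine ⟨L2e.mk _ fun T => h.mono_measure (restrict_Icc_le_halfLine T), ?_⟩
  filter_upwards [L2e.val_mk _ fun T => h.mono_measure (restrict_Icc_le_halfLine T)] with t ht
  exact congrArg WithLp.ofLp ht

lemma vec_trunc (T : ℝ) (x : L2e n) : (x.trunc T).vec =ᵐ[halfLine] (Icc 0 T).indicator x.vec := by
  filter_upwards [L2e.val_mk ((Icc 0 T).indicator x.val)
    fun S => (x.2 S).indicator measurableSet_Icc] with t ht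
  refine (congrArg WithLp.ofLp ht).trans ?_
  by_cases h : t ∈ Icc 0 T
  · simp only [indicator_of_mem h]; rfl
  · simp only [indicator_of_notMem h]; rfl

lemma trunc_eq_trunc_iff {T : ℝ} {x y : L2e n} :
    x.trunc T = y.trunc T ↔ x.vec =ᵐ[volume.restrict (Icc 0 T)] y.vec := by
  refine ⟨fun h => ?_, fun h => ext_vec ?_⟩
  · have h1 := (vec_trunc T x).symm.trans (h ▸ vec_trunc T y)
    filter_upwards [ae_Icc_of_ae_halfLine h1 T, ae_restrict_mem measurableSet_Icc] with t ht hT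
    simpa only [indicator_of_mem hT] using ht
  · refine (vec_trunc T x).trans (Filter.EventuallyEq.trans ?_ (vec_trunc T y).symm)
    filter_upwards [ae_restrict_of_ae ((ae_restrict_iff' measurableSet_Icc).1 h)] with t ht
    by_cases hT : t ∈ Icc 0 T
    · simp only [indicator_of_mem hT, ht hT]
    · simp only [indicator_of_notMem hT]

end L2e

lemma IsCausal.vec_eq {n m : ℕ} {S : L2e n → L2e m} (hS : IsCausal S) {T : ℝ} (hT : 0 < T)
    {x y : L2e n} (h : x.vec =ᵐ[volume.restrict (Icc 0 T)] y.vec) :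
    (S x).vec =ᵐ[volume.restrict (Icc 0 T)] (S y).vec := by
  rw [← L2e.trunc_eq_trunc_iff] at h ⊢
  rw [hS T hT x, hS T hT y, h]

lemma IsBoundedSystem.inL2 {n m : ℕ} {S : L2e n → L2e m} (hS : IsBoundedSystem S) {x : L2e n}
    (hx : x.InL2) : (S x).InL2 := by
  obtain ⟨γ, hγ⟩ := hS
  exact (hγ x hx).trans_lt (ENNReal.mul_lt_top ENNReal.coe_lt_top hx)

/-! ### The system of a stable transfer matrix -/

section ioMap

variable {m p : ℕ} {H : Matrix (Fin p) (Fin m) (RatFunc ℝ)} (hH : IsRHInfty H)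

/-- `ioMap` picks an output separately for each input, so nothing ties different inputs together by
definition. A single realization serving all of them makes outputs comparable through uniqueness of
state trajectories. -/
lemma exists_realization_ioMap : ∃ r : StableRealization H, ∀ w : L2e m, ∃ η : ℝ → Fin r.n → ℝ,
    IsPrimitive (fun t => r.A *ᵥ η t + r.B *ᵥ w.vec t) η ∧
      ∀ᵐ t ∂halfLine, (ioMap H hH w).vec t = r.C *ᵥ η t + r.D *ᵥ w.vec t := by
  refine ⟨Classical.choice (nonempty_stableRealization hH), fun w => ?_⟩
  obtain ⟨η, h1, h2⟩ := Classical.choose_spec (exists_isOutput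
    (Classical.choice (nonempty_stableRealization hH)).A _
    (Classical.choice (nonempty_stableRealization hH)).C _ w)
  exact ⟨η, isPrimitive_of_isStateTrajectory h1 w.integrableOn, h2⟩

lemma ioMap_vec_eq {w₁ w₂ : L2e m} {T : ℝ} (h : w₁.vec =ᵐ[volume.restrict (Icc 0 T)] w₂.vec) :
    (ioMap H hH w₁).vec =ᵐ[volume.restrict (Icc 0 T)] (ioMap H hH w₂).vec := by
  obtain ⟨r, hr⟩ := exists_realization_ioMap hH
  obtain ⟨η₁, h1, hz1⟩ := hr w₁
  obtain ⟨η₂, h2, hz2⟩ := hr w₂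
  have h3 := eq_of_isPrimitive h1 h2 (h.mono fun t ht => by rw [ht])
  filter_upwards [h, ae_Icc_of_ae_halfLine hz1 T, ae_Icc_of_ae_halfLine hz2 T,
    ae_restrict_mem measurableSet_Icc] with t e1 e2 e3 ht
  rw [e2, e3, e1, h3 t ht]

lemma ioMap_inL2 {w : L2e m} (hw : w.InL2) : (ioMap H hH w).InL2 := by
  obtain ⟨r, hr⟩ := exists_realization_ioMap hH
  obtain ⟨η, h1, hz⟩ := hr w
  rw [L2e.inL2_iff] at hw ⊢
  have hη := memLp_of_isHurwitz r.hurwitz (MemLp.mulVec r.B hw) h1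
  exact (memLp_congr_ae hz).2 ((MemLp.mulVec r.C hη).add (MemLp.mulVec r.D hw))

/-- The difference of the states chosen for `w₁` and `w₂` solves the state equation with input `w₁ -
w₂`, and so equals the state chosen for that input. -/
lemma ioMap_sub (w₁ w₂ : L2e m) :
    ioMap H hH (w₁ - w₂) = ioMap H hH w₁ - ioMap H hH w₂ := by
  obtain ⟨r, hr⟩ := exists_realization_ioMap hH
  obtain ⟨η₁, h1, hz1⟩ := hr w₁
  obtain ⟨η₂, h2, hz2⟩ := hr w₂
  obtain ⟨η₃, h3, hz3⟩ := hr (w₁ - w₂)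
  have h4 : IsPrimitive (fun t => r.A *ᵥ (η₁ t - η₂ t) + r.B *ᵥ (w₁ - w₂).vec t)
      (fun t => η₁ t - η₂ t) := by
    refine (h1.sub h2).congr ?_
    filter_upwards [L2e.vec_sub w₁ w₂] with t ht
    rw [ht, Matrix.mulVec_sub, Matrix.mulVec_sub]
    abel
  refine L2e.ext_vec ?_
  filter_upwards [hz1, hz2, hz3, L2e.vec_sub w₁ w₂, L2e.vec_sub (ioMap H hH w₁) (ioMap H hH w₂),
    ae_restrict_mem measurableSet_Ici] with t e1 e2 e3 e4 e5 ht
  rw [e5, e1, e2, e3, e4, eq_of_isPrimitive h3 h4 (T := t)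
    (Filter.Eventually.of_forall fun _ => rfl) t ⟨ht, le_rfl⟩, Matrix.mulVec_sub,
    Matrix.mulVec_sub]
  abel

lemma hatVec_ioMap {w : L2e m} (hw : MemLp w.vec 2 halfLine)
    (hz : MemLp (ioMap H hH w).vec 2 halfLine) :
    ∀ᵐ s : ℝ, hatVec (ioMap H hH w).vec hz s =
      evalMatrix H (Complex.I * (2 * Real.pi * s : ℝ)) *ᵥ hatVec w.vec hw s := by
  obtain ⟨r, hr⟩ := exists_realization_ioMap hH
  obtain ⟨η, h1, hzη⟩ := hr w
  have hη := memLp_of_isHurwitz r.hurwitz (MemLp.mulVec r.B hw) h1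
  filter_upwards [hatVec_output r.hurwitz h1 hη hw r.C r.D hz hzη] with s hs
  rw [hs, r.transfer_eq _ (by simp)]

end ioMap

/-! ### The two constraints in the time domain -/

lemma MemLp.sumElim {ι κ : Type} [Fintype ι] [Fintype κ] {μ : Measure ℝ} {f : ℝ → ι → ℝ}
    {g : ℝ → κ → ℝ} (hf : MemLp f 2 μ) (hg : MemLp g 2 μ) :
    MemLp (fun t => Sum.elim (f t) (g t)) 2 μ :=
  MemLp.of_eval fun i => by
    rcases i with i | i
    · exact hf.eval i
    · exact hg.eval i

lemma hatVec_sumElim {ι κ : Type} [Fintype ι] [Fintype κ] {f : ℝ → ι → ℝ}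
    {g : ℝ → κ → ℝ} (hf : MemLp f 2 halfLine) (hg : MemLp g 2 halfLine) (s : ℝ) :
    hatVec (fun t => Sum.elim (f t) (g t)) (MemLp.sumElim hf hg) s =
      Sum.elim (hatVec f hf s) (hatVec g hg s) := by
  ext i
  rcases i with i | i <;> rfl

section IQC

variable {σ κ : Type} [Fintype σ] [DecidableEq σ] [Fintype κ] {p m : ℕ} {A : Matrix σ σ ℝ}
  {B : Matrix σ (Fin p ⊕ Fin m) ℝ} {C : Matrix κ σ ℝ} {D : Matrix κ (Fin p ⊕ Fin m) ℝ}
  {M : Matrix κ κ ℝ} {ξ : ℝ → σ → ℝ}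

/-- The integral quadratic constraint in the time domain. -/
lemma SatisfiesIQC.integral_nonneg {Δ : L2e p → L2e m}
    (h : SatisfiesIQC Δ (multiplier A B C D M)) (hA : IsHurwitz A) {z : L2e p} (hz : z.InL2)
    (hw : (Δ z).InL2)
    (hξ : IsPrimitive (fun t => A *ᵥ ξ t + B *ᵥ Sum.elim (z.vec t) ((Δ z).vec t)) ξ) :
    0 ≤ ∫ t, (C *ᵥ ξ t + D *ᵥ Sum.elim (z.vec t) ((Δ z).vec t)) ⬝ᵥ
      (M *ᵥ (C *ᵥ ξ t + D *ᵥ Sum.elim (z.vec t) ((Δ z).vec t))) ∂halfLine := by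
  have hz2 := L2e.inL2_iff.1 hz
  have hw2 := L2e.inL2_iff.1 hw
  have hu := MemLp.sumElim hz2 hw2
  have hξ2 := memLp_of_isHurwitz hA (MemLp.mulVec B hu) hξ
  rw [integral_quadratic_output hA hξ hξ2 hu C D M]
  -- The constraint is stated in `ω` and Parseval in `s` with `ω = 2πs`; the positive factor from
  -- this substitution does not affect the sign.
  have h1 := Measure.integral_comp_mul_left (fun ω : ℝ =>
    (star (Sum.elim (z.hat hz ω) ((Δ z).hat hw ω)) ⬝ᵥ
      (multiplier A B C D M ω *ᵥ Sum.elim (z.hat hz ω) ((Δ z).hat hw ω))).re) (2 * Real.pi)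
  have h2 : ∀ s : ℝ, Sum.elim (z.hat hz (2 * Real.pi * s)) ((Δ z).hat hw (2 * Real.pi * s)) =
      hatVec (fun t => Sum.elim (z.vec t) ((Δ z).vec t)) hu s := fun s => by
    rw [hatVec_sumElim hz2 hw2]
    have h3 : 2 * Real.pi * s / (2 * Real.pi) = s := by
      field_simp
    have h4 : z.hat hz (2 * Real.pi * s) =
      hatVec z.vec hz2 (2 * Real.pi * s / (2 * Real.pi)) := rfl
    have h5 : (Δ z).hat hw (2 * Real.pi * s) =
      hatVec (Δ z).vec hw2 (2 * Real.pi * s / (2 * Real.pi)) := rfl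
    rw [h4, h5, h3]
  simp only [h2] at h1
  rw [h1]
  exact mul_nonneg (abs_nonneg _) (h z hz hw)

/-- The frequency domain inequality in the time domain. -/
lemma SatisfiesFDI.integral_nonpos {H : Matrix (Fin p) (Fin m) (RatFunc ℝ)} (hH : IsRHInfty H)
    (h : SatisfiesFDI H (multiplier A B C D M)) (hA : IsHurwitz A) {w : L2e m} (hw : w.InL2)
    (hξ : IsPrimitive (fun t => A *ᵥ ξ t + B *ᵥ Sum.elim ((ioMap H hH w).vec t) (w.vec t)) ξ) :
    ∫ t, (C *ᵥ ξ t + D *ᵥ Sum.elim ((ioMap H hH w).vec t) (w.vec t)) ⬝ᵥ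
      (M *ᵥ (C *ᵥ ξ t + D *ᵥ Sum.elim ((ioMap H hH w).vec t) (w.vec t))) ∂halfLine ≤ 0 := by
  have hw2 := L2e.inL2_iff.1 hw
  have hz2 := L2e.inL2_iff.1 (ioMap_inL2 hH hw)
  have hu := MemLp.sumElim hz2 hw2
  have hξ2 := memLp_of_isHurwitz hA (MemLp.mulVec B hu) hξ
  rw [integral_quadratic_output hA hξ hξ2 hu C D M]
  refine integral_nonpos_of_ae ?_
  filter_upwards [hatVec_ioMap hH hw2 hz2] with s hs
  rw [hatVec_sumElim hz2 hw2, hs]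
  -- The input transform is `col(H, I) ŵ`, so the integrand is nonpositive pointwise.
  have h1 := (h (2 * Real.pi * s)).re_dotProduct_nonneg (hatVec w.vec hw2 s)
  have h2 : Sum.elim (evalMatrix H (Complex.I * (2 * Real.pi * s : ℝ)) *ᵥ hatVec w.vec hw2 s)
      (hatVec w.vec hw2 s) = Matrix.fromRows (evalMatrix H (Complex.I * (2 * Real.pi * s : ℝ)))
        (1 : Matrix (Fin m) (Fin m) ℂ) *ᵥ hatVec w.vec hw2 s := by
    rw [Matrix.fromRows_mulVec, Matrix.one_mulVec]
  rw [h2, Matrix.star_mulVec, ← Matrix.dotProduct_mulVec, Matrix.mulVec_mulVec,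
    Matrix.mulVec_mulVec]
  rw [Matrix.neg_mulVec, dotProduct_neg] at h1
  simpa using h1

end IQC

/-! ### Extension of finite horizon trajectories -/

/-- Trajectories on `[0, T]` of a filter with stable inverse extend to square integrable
trajectories on `[0, ∞)` for which the output vanishes after `T`. -/
lemma exists_extension {σ ι : Type} [Fintype σ] [DecidableEq σ] [Fintype ι] [DecidableEq ι]
    {A : Matrix σ σ ℝ} {B : Matrix σ ι ℝ} {C : Matrix ι σ ℝ} {D : Matrix ι ι ℝ}
    (hD : IsUnit D.det) (hA : IsHurwitz (A - B * D⁻¹ * C)) {ξ : ℝ → σ → ℝ} {u : ℝ → ι → ℝ}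
    (hξ : IsPrimitive (fun t => A *ᵥ ξ t + B *ᵥ u t) ξ) {T : ℝ} (hT : 0 ≤ T)
    (hu : MemLp u 2 (volume.restrict (Icc 0 T))) :
    ∃ (ζ : ℝ → σ → ℝ) (v : ℝ → ι → ℝ), MemLp v 2 halfLine ∧ MemLp ζ 2 halfLine ∧
      IsPrimitive (fun t => A *ᵥ ζ t + B *ᵥ v t) ζ ∧ (∀ t ∈ Icc 0 T, v t = u t) ∧
      ∀ t, C *ᵥ ζ t + D *ᵥ v t = (Icc 0 T).indicator (fun t => C *ᵥ ξ t + D *ᵥ u t) t := by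
  have hξ2 := hξ.memLp_Icc hT
  have hCu : MemLp (fun t => C *ᵥ ξ t + D *ᵥ u t) 2 (volume.restrict (Icc 0 T)) :=
    (MemLp.mulVec C hξ2).add (MemLp.mulVec D hu)
  let q : ℝ → ι → ℝ := (Icc 0 T).indicator fun t => C *ᵥ ξ t + D *ᵥ u t
  have hq : MemLp q 2 halfLine :=
    ((memLp_indicator_iff_restrict measurableSet_Icc).2 hCu).restrict _
  have hinv : ∀ a : ι → ℝ, D⁻¹ *ᵥ (D *ᵥ a) = a := fun a => by
    rw [Matrix.mulVec_mulVec, Matrix.nonsing_inv_mul _ hD, Matrix.one_mulVec]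
  have hinv' : ∀ a : ι → ℝ, D *ᵥ (D⁻¹ *ᵥ a) = a := fun a => by
    rw [Matrix.mulVec_mulVec, Matrix.mul_nonsing_inv _ hD, Matrix.one_mulVec]
  have hqi := fun S : ℝ => MemLp.integrableOn_Icc hq S
  -- The inverse filter is driven by the output `q` truncated at `T`; solving `q = C ζ + D v` for
  -- `v` gives the extended input.
  obtain ⟨ζ, hζ'⟩ := exists_isStateTrajectory (A - B * D⁻¹ * C) (B * D⁻¹) q hqi
  have hζ := isPrimitive_of_isStateTrajectory hζ' hqi
  have hζ2 := memLp_of_isHurwitz hA (MemLp.mulVec (B * D⁻¹) hq) hζ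
  -- Expressed through its own output, `ξ` obeys the equation of the inverse filter, with the same
  -- forcing as `ζ` up to time `T`.
  have hξ' : IsPrimitive (fun t => (A - B * D⁻¹ * C) *ᵥ ξ t +
      (B * D⁻¹) *ᵥ (C *ᵥ ξ t + D *ᵥ u t)) ξ := by
    refine hξ.congr (Filter.Eventually.of_forall fun t => ?_)
    simp only [Matrix.sub_mulVec, ← Matrix.mulVec_mulVec, Matrix.mulVec_add, hinv]
    abel
  have hζξ : ∀ t ∈ Icc 0 T, ζ t = ξ t := by
    refine eq_of_isPrimitive hζ hξ' ?_
    filter_upwards [ae_restrict_mem measurableSet_Icc] with t ht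
    simp only [q, indicator_of_mem ht]
  refine ⟨ζ, fun t => D⁻¹ *ᵥ (q t - C *ᵥ ζ t), MemLp.mulVec _ (hq.sub (MemLp.mulVec C hζ2)), hζ2,
    ?_, fun t ht => ?_, fun t => ?_⟩
  · refine hζ.congr (Filter.Eventually.of_forall fun t => ?_)
    simp only [Matrix.sub_mulVec, ← Matrix.mulVec_mulVec, Matrix.mulVec_sub]
    abel
  · simp only [q, indicator_of_mem ht, hζξ t ht, add_sub_cancel_left, hinv]
  · rw [hinv', add_sub_cancel]

/-! ### The feedback argument -/

theorem mainTheorem4 (nz nw nξ ny : ℕ)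
    -- the uncertainty
    (Δ : L2e nz → L2e nw) (hΔc : IsCausal Δ) (hΔb : IsBoundedSystem Δ)
    -- the multiplier `Π = Ψ^* M Ψ` with the stable filter `Ψ = (A, B, C, D)`
    (A : Matrix (Fin nξ) (Fin nξ) ℝ) (B : Matrix (Fin nξ) (Fin nz ⊕ Fin nw) ℝ)
    (C : Matrix (Fin ny) (Fin nξ) ℝ) (D : Matrix (Fin ny) (Fin nz ⊕ Fin nw) ℝ)
    (hA : IsHurwitz A) (M : Matrix (Fin ny) (Fin ny) ℝ) (hM : M.IsSymm)
    (hIQC : SatisfiesIQC Δ (multiplier A B C D M))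
    (Z : Matrix (Fin nξ) (Fin nξ) ℝ) (hZ : CertifiesCanonicalFactorization A B C D M Z)
    -- the stable transfer matrix `H` with `col(H, I)^* Π col(H, I) ⪯ 0` on the imaginary axis
    (H : Matrix (Fin nz) (Fin nw) (RatFunc ℝ)) (hH : IsRHInfty H)
    (hFDI : SatisfiesFDI H (multiplier A B C D M))
    -- `I - H Δ` has a causal and bounded inverse `S`
    (hinv : ∃ S : L2e nz → L2e nz,
      (∀ z : L2e nz, S (z - ioMap H hH (Δ z)) = z) ∧
      (∀ d : L2e nz, S d - ioMap H hH (Δ (S d)) = d) ∧ IsCausal S ∧ IsBoundedSystem S) :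
    SatisfiesFiniteHorizonIQC Δ A B C D M Z := by
  obtain ⟨hZs, M', C', D', -, hD', hcert, hHur⟩ := hZ
  obtain ⟨S, hS1, hS2, hSc, hSb⟩ := hinv
  refine ⟨hZs, ?_⟩
  rintro z u ξ y hu hξ0 rfl T hT
  have huv : u = fun t => Sum.elim (z.vec t) ((Δ z).vec t) := hu
  have hu2 : ∀ R : ℝ, MemLp u 2 (volume.restrict (Icc 0 R)) := fun R => by
    rw [huv]
    exact MemLp.sumElim (z.memLp_vec_Icc R) ((Δ z).memLp_vec_Icc R)
  have hξ := isPrimitive_of_isStateTrajectory hξ0 fun R => (hu2 R).integrable (by norm_num)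
  rw [intervalIntegral_dissipation hcert hξ hT.le (hu2 T)]
  -- the extension beyond the horizon
  obtain ⟨ζ, v, hv2, hζ2, hζ, hvu, hq⟩ := exists_extension hD' hHur hξ hT.le (hu2 T)
  obtain ⟨zT, hzT⟩ := L2e.exists_vec_eq (MemLp.of_eval fun i => hv2.eval (Sum.inl i))
  obtain ⟨wT, hwT⟩ := L2e.exists_vec_eq (MemLp.of_eval fun i => hv2.eval (Sum.inr i))
  have hzT2 : zT.InL2 := L2e.inL2_iff.2
    ((memLp_congr_ae hzT).2 (MemLp.of_eval fun i => hv2.eval (Sum.inl i)))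
  have hwT2 : wT.InL2 := L2e.inL2_iff.2
    ((memLp_congr_ae hwT).2 (MemLp.of_eval fun i => hv2.eval (Sum.inr i)))
  have hvT : v =ᵐ[halfLine] fun t => Sum.elim (zT.vec t) (wT.vec t) := by
    filter_upwards [hzT, hwT] with t h1 h2
    rw [h1, h2]
    ext i
    rcases i with i | i <;> rfl
  have hzTz : zT.vec =ᵐ[volume.restrict (Icc 0 T)] z.vec := by
    filter_upwards [ae_Icc_of_ae_halfLine hzT T, ae_restrict_mem measurableSet_Icc] with t h1 ht
    rw [h1]
    ext i
    rw [hvu t ht, huv]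
    rfl
  have hwTw : wT.vec =ᵐ[volume.restrict (Icc 0 T)] (Δ z).vec := by
    filter_upwards [ae_Icc_of_ae_halfLine hwT T, ae_restrict_mem measurableSet_Icc] with t h1 ht
    rw [h1]
    ext i
    rw [hvu t ht, huv]
    rfl
  -- the closed loop response to the resulting disturbance
  let d : L2e nz := zT - ioMap H hH wT
  have hsub : ∀ {a b : L2e nz}, a.InL2 → b.InL2 → (a - b).InL2 := fun {a b} ha hb =>
    L2e.inL2_iff.2 ((memLp_congr_ae (L2e.vec_sub a b)).2
      ((L2e.inL2_iff.1 ha).sub (L2e.inL2_iff.1 hb)))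
  have hd2 : d.InL2 := hsub hzT2 (ioMap_inL2 hH hwT2)
  let z' : L2e nz := S d
  let w' : L2e nw := Δ z'
  have hz'2 : z'.InL2 := hSb.inL2 hd2
  have hw'2 : w'.InL2 := hΔb.inL2 hz'2
  have hz'z : z'.vec =ᵐ[volume.restrict (Icc 0 T)] z.vec := by
    -- On `[0, T]` the disturbance `d` agrees with `z - H Δ(z)`, whose image under the causal `S` is
    -- `z`.
    rw [← hS1 z]
    refine hSc.vec_eq hT ?_
    filter_upwards [ae_Icc_of_ae_halfLine (L2e.vec_sub zT (ioMap H hH wT)) T,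
      ae_Icc_of_ae_halfLine (L2e.vec_sub z (ioMap H hH (Δ z))) T, hzTz,
      ioMap_vec_eq hH hwTw] with t h1 h2 h3 h4
    rw [h1, h2, h3, h4]
  have hw'w : w'.vec =ᵐ[volume.restrict (Icc 0 T)] (Δ z).vec := hΔc.vec_eq hT hz'z
  -- the difference from the extension
  let e : L2e nw := w' - wT
  have he : e.vec =ᵐ[halfLine] fun t => w'.vec t - wT.vec t := L2e.vec_sub w' wT
  have he2 : e.InL2 := L2e.inL2_iff.2 ((memLp_congr_ae he).2
    ((L2e.inL2_iff.1 hw'2).sub (L2e.inL2_iff.1 hwT2)))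
  have he0 : ∀ᵐ t ∂volume.restrict (Icc 0 T), e.vec t = 0 := by
    filter_upwards [ae_Icc_of_ae_halfLine he T, hw'w, hwTw] with t h1 h2 h3
    rw [h1, h2, h3, sub_self]
  have hHe : (ioMap H hH e).vec =ᵐ[halfLine] fun t => z'.vec t - zT.vec t := by
    have h1 : ioMap H hH e = z' - zT := by
      -- Both pairs `(z', w')` and `(zT, wT)` produce the same disturbance `d`; subtracting gives `H
      -- e = z' - zT`.
      have h2 : z' - ioMap H hH w' = zT - ioMap H hH wT := hS2 d
      rw [ioMap_sub hH]
      refine Subtype.ext ?_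
      have h3 : z'.1 - (ioMap H hH w').1 = zT.1 - (ioMap H hH wT).1 := congrArg Subtype.val h2
      change (ioMap H hH w').1 - (ioMap H hH wT).1 = z'.1 - zT.1
      rw [sub_eq_sub_iff_add_eq_add] at h3 ⊢
      rw [add_comm, ← h3, add_comm]
    rw [h1]
    exact L2e.vec_sub z' zT
  have hHe0 : ∀ᵐ t ∂volume.restrict (Icc 0 T), (ioMap H hH e).vec t = 0 := by
    filter_upwards [ae_Icc_of_ae_halfLine hHe T, hz'z, hzTz] with t h1 h2 h3
    rw [h1, h2, h3, sub_self]
  let u' : ℝ → Fin nz ⊕ Fin nw → ℝ := fun t => Sum.elim (z'.vec t) (w'.vec t)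
  let ue : ℝ → Fin nz ⊕ Fin nw → ℝ := fun t => Sum.elim ((ioMap H hH e).vec t) (e.vec t)
  have hu'2 : MemLp u' 2 halfLine :=
    MemLp.sumElim (L2e.inL2_iff.1 hz'2) (L2e.inL2_iff.1 hw'2)
  have hue2 : MemLp ue 2 halfLine :=
    MemLp.sumElim (L2e.inL2_iff.1 (ioMap_inL2 hH he2)) (L2e.inL2_iff.1 he2)
  have hue : ue =ᵐ[halfLine] fun t => u' t - v t := by
    filter_upwards [he, hHe, hvT] with t h1 h2 h3
    simp only [ue, u', h1, h2, h3]
    ext i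
    rcases i with i | i <;> rfl
  have hue0 : ∀ᵐ t ∂volume.restrict (Icc 0 T), ue t = 0 := by
    filter_upwards [he0, hHe0] with t h1 h2
    simp only [ue, h1, h2]
    ext i
    rcases i with i | i <;> rfl
  obtain ⟨ξ', hξ'0⟩ := exists_isStateTrajectory A B u' fun R => MemLp.integrableOn_Icc hu'2 R
  have hξ' := isPrimitive_of_isStateTrajectory hξ'0 fun R => MemLp.integrableOn_Icc hu'2 R
  have hξ'2 := memLp_of_isHurwitz hA (MemLp.mulVec B hu'2) hξ'
  have hχ : IsPrimitive (fun t => A *ᵥ (ξ' t - ζ t) + B *ᵥ ue t) (fun t => ξ' t - ζ t) := by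
    refine (hξ'.sub hζ).congr ?_
    filter_upwards [hue] with t ht
    rw [ht, Matrix.mulVec_sub, Matrix.mulVec_sub]
    abel
  have hχ2 : MemLp (fun t => ξ' t - ζ t) 2 halfLine := hξ'2.sub hζ2
  have hχ0 : ∀ t ∈ Icc 0 T, ξ' t - ζ t = 0 :=
    eq_zero_of_isPrimitive hχ (hue0.mono fun t ht => by rw [ht, Matrix.mulVec_zero])
  -- comparison of the costs
  have hcost1 := hIQC.integral_nonneg hA hz'2 hw'2 hξ'
  have hcost2 := hFDI.integral_nonpos hH hA he2 hχ
  have hint2 := integrable_quadratic_output C' D' M' hχ2 hue2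
  have hint1 := integrable_quadratic_output C' D' M' hζ2 hv2
  rw [integral_dissipation hcert hξ' hξ'2 hu'2] at hcost1
  rw [integral_dissipation hcert hχ hχ2 hue2] at hcost2
  have hsplit : ∫ t, (C' *ᵥ ξ' t + D' *ᵥ u' t) ⬝ᵥ (M' *ᵥ (C' *ᵥ ξ' t + D' *ᵥ u' t)) ∂halfLine =
      (∫ t, (C' *ᵥ ζ t + D' *ᵥ v t) ⬝ᵥ (M' *ᵥ (C' *ᵥ ζ t + D' *ᵥ v t)) ∂halfLine) +
      ∫ t, (C' *ᵥ (ξ' t - ζ t) + D' *ᵥ ue t) ⬝ᵥ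
        (M' *ᵥ (C' *ᵥ (ξ' t - ζ t) + D' *ᵥ ue t)) ∂halfLine := by
    rw [← integral_add hint1 hint2]
    refine integral_congr_ae ?_
    filter_upwards [hue, ae_restrict_of_ae ((ae_restrict_iff' measurableSet_Icc).1 hue0)]
      with t h1 h2
    have h3 : C' *ᵥ ξ' t + D' *ᵥ u' t =
        (C' *ᵥ ζ t + D' *ᵥ v t) + (C' *ᵥ (ξ' t - ζ t) + D' *ᵥ ue t) := by
      rw [h1, Matrix.mulVec_sub, Matrix.mulVec_sub]
      abel
    rw [h3]
    -- The cross term vanishes pointwise: up to `T` the output due to `ue` is zero, and after `T`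
    -- the output due to `v` is zero.
    by_cases ht : t ∈ Icc 0 T
    · simp [hχ0 t ht, h2 ht]
    · simp [hq t, indicator_of_notMem ht]
  have hfin : ∫ t, (C' *ᵥ ζ t + D' *ᵥ v t) ⬝ᵥ (M' *ᵥ (C' *ᵥ ζ t + D' *ᵥ v t)) ∂halfLine =
      ∫ t in (0 : ℝ)..T, (C' *ᵥ ξ t + D' *ᵥ u t) ⬝ᵥ (M' *ᵥ (C' *ᵥ ξ t + D' *ᵥ u t)) := by
    rw [intervalIntegral.integral_of_le hT.le, ← integral_Icc_eq_integral_Ioc,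
      ← integral_indicator measurableSet_Icc, ← setIntegral_eq_integral_of_forall_compl_eq_zero
        (s := Ici (0 : ℝ)) fun t ht => indicator_of_notMem (fun h => ht h.1) _]
    refine integral_congr_ae (Filter.Eventually.of_forall fun t => ?_)
    simp only [hq t]
    by_cases ht : t ∈ Icc 0 T
    · simp only [indicator_of_mem ht]
    · simp [indicator_of_notMem ht]
  rw [hsplit, hfin] at hcost1
  linarith
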